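/- Let $M=T^*\mathbb{R}^2=\mathbb{R}^4$ with coordinates $(q_1,q_2,p_1,p_2)$ and symplectic form $\Omega=dq_1\wedge dp_1+dq_2\wedge dp_2$. Let $\omega$ be a smooth real $2$-form on $M$ that is closed ($d\omega=0$) and primitive ($\omega\wedge\Omega=0$). Define the tensor $A$ by $\omega=\Omega(A\cdot,\cdot)$, and let $$\mathbb{J}(X+\xi)=(AX+\Omega^{-1}\xi)+(\tilde\omega X-A^*\xi),\qquad \tilde\omega=-\Omega((1+A^2)\cdot,\cdot),$$ be the generalized complex structure on $T\oplus T^*$ associated with $(\omega,\Omega)$, where $\Omega^{-1}$ is the inverse of $X\mapsto\iota_X\Omega$. Let $\overline{E}=\operatorname{Ker}(\mathbb{J}+i)\subset (T\oplus T^*)\otimes\mathbb{C}$, $\rho(X+\xi)\theta=\iota_X\theta+\xi\wedge\theta$, $\Phi=\exp(\omega-i\Omega)$ and $U_k=\rho(\Lambda^{2-k}\overline{E})(\Phi)$ for $-2\le k\le 2$, so that $\Lambda^*(T^*)\otimes\mathbb{C}=\bigoplus_{k=-2}^{2}U_k$, with projections $\pi_k$ onto $U_k$. On sections of $U_k$ put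 $\overline{\partial}=\pi_{k+1}\circ d$ and $\partial=\pi_{k-1}\circ d$. Let $U=\omega\wedge\Phi$ and $V=(i\Omega+1)\wedge\Phi$. Let $f,g$ be smooth real functions on $M$. Say that $f$ is a generating function of the Monge–Ampère equation $\Delta_\omega=0$ with conjugate function $g$ if $f\omega+g\Omega=d\alpha$ for some smooth real $1$-form $\alpha$ on $M$. Then $U$ and $V$ are real forms and sections of $U_0$, and the following are equivalent: 1. $f$ is a generating function of $\Delta_\omega=0$ with conjugate function $g$; 2. $\overline{\partial}(fU+igV)=0$; 3. $\partial(fU-igV)=0$. The underlying identities are $$\overline{\partial}(fU+igV)=\pi_1(df\wedge\omega+dg\wedge\Omega),\qquad \partial(fU-igV)=\pi_{-1}(df\wedge\omega+dg\wedge\Omega),$$ and the real parts of $2\overline{\partial}(fU+igV)$ and of $2\partial(fU-igV)$ are both equal to $df\wedge\omega+dg\wedge\Omega$. (In the convention in which $\overline{\partial}$ denotes the operator $\pi_{k-1}\circ d$ on sections of $U_k$, statement 3 reads $\overline{\partial}(fU-igV)=0$.) -/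

import Mathlib

noncomputable section

namespace MongeAmpere

/-- The manifold `M = T*ℝ²`, identified with `ℝ⁴` through the canonical coordinates
`(q₁, q₂, p₁, p₂)`, numbered `0, 1, 2, 3`. -/
abbrev Phase : Type := Fin 4 → ℝ

/-- The tangent vectors `∂/∂q₁, ∂/∂q₂, ∂/∂p₁, ∂/∂p₂`. -/
def coordVec (i : Fin 4) : Phase := Pi.single i 1

/-! ### Exterior product -/

section Wedge

variable {𝔸 : Type*} [NormedCommRing 𝔸] [NormedAlgebra ℝ 𝔸]

/-- The multilinear map `(v₁, …, vₙ) ↦ a (v₁, …, v_p) * b (v_{p+1}, …, vₙ)`, where `n = p + q`. -/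
def concatProd {p q n : ℕ} (h : p + q = n)
    (a : Phase [⋀^Fin p]→L[ℝ] 𝔸) (b : Phase [⋀^Fin q]→L[ℝ] 𝔸) :
    ContinuousMultilinearMap ℝ (fun _ : Fin n => Phase) 𝔸 where
  toMultilinearMap :=
    ((LinearMap.mul' ℝ 𝔸).compMultilinearMap
      (a.toMultilinearMap.domCoprod b.toMultilinearMap)).domDomCongr
        (finSumFinEquiv.trans (finCongr h))
  cont := by
    have e : ∀ v : Fin n → Phase,
        ((LinearMap.mul' ℝ 𝔸).compMultilinearMap
          (a.toMultilinearMap.domCoprod b.toMultilinearMap)).domDomCongr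
            (finSumFinEquiv.trans (finCongr h)) v
        = a (fun i => v (Fin.cast h (Fin.castAdd q i))) *
          b (fun j => v (Fin.cast h (Fin.natAdd p j))) := fun _ => rfl
    refine (Continuous.congr ?_ fun v => (e v).symm)
    exact (a.cont.comp (continuous_pi fun i => continuous_apply _)).mul
      (b.cont.comp (continuous_pi fun i => continuous_apply _))

theorem concatProd_apply {p q n : ℕ} (h : p + q = n)
    (a : Phase [⋀^Fin p]→L[ℝ] 𝔸) (b : Phase [⋀^Fin q]→L[ℝ] 𝔸) (v : Fin n → Phase) :
    concatProd h a b v = a (fun i => v (Fin.cast h (Fin.castAdd q i))) *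
      b (fun j => v (Fin.cast h (Fin.natAdd p j))) := rfl

/-- The exterior product of a `p`-covector and a `q`-covector, `n = p + q`:
`(a ∧ b)(v₁, …, vₙ) = 1/(p! q!) ∑_σ sgn σ a(v_{σ 1}, …, v_{σ p}) b(v_{σ (p+1)}, …, v_{σ n})`. -/
def wedge {p q n : ℕ} (h : p + q = n)
    (a : Phase [⋀^Fin p]→L[ℝ] 𝔸) (b : Phase [⋀^Fin q]→L[ℝ] 𝔸) : Phase [⋀^Fin n]→L[ℝ] 𝔸 :=
  ((p.factorial * q.factorial : ℝ)⁻¹) • (concatProd h a b).alternatization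

end Wedge

/-! ### The symplectic form, generating functions -/

/-- The coordinate covectors `dq₁, dq₂, dp₁, dp₂`. -/
def coordForm (i : Fin 4) : Phase [⋀^Fin 1]→L[ℝ] ℝ :=
  ContinuousAlternatingMap.ofSubsingleton ℝ Phase ℝ (0 : Fin 1) (ContinuousLinearMap.proj i)

/-- The canonical symplectic form `Ω = dq₁ ∧ dp₁ + dq₂ ∧ dp₂`. -/
def Omega : Phase [⋀^Fin 2]→L[ℝ] ℝ :=
  wedge rfl (coordForm 0) (coordForm 2) + wedge rfl (coordForm 1) (coordForm 3)

/-- A real `2`-form `ω` is primitive when `ω ∧ Ω = 0`. -/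
def IsPrimitive (ω : Phase → Phase [⋀^Fin 2]→L[ℝ] ℝ) : Prop :=
  ∀ x, wedge (n := 4) rfl (ω x) Omega = 0

/-- `f` is a generating function of the Monge-Ampère equation `Δ_ω = 0` with conjugate function
`g`: the form `f ω + g Ω` is the differential of a smooth `1`-form `α` (a conservation law). -/
def IsGeneratingWithConjugate (ω : Phase → Phase [⋀^Fin 2]→L[ℝ] ℝ) (f g : Phase → ℝ) : Prop :=
  ∃ α : Phase → Phase [⋀^Fin 1]→L[ℝ] ℝ, ContDiff ℝ ((⊤ : ℕ∞) : WithTop ℕ∞) α ∧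
    ∀ x, extDeriv α x = f x • ω x + g x • Omega

/-! ### Complex forms of mixed degree -/

/-- `Λ*(T*) ⊗ ℂ` at a point: families of complex covectors of all degrees
(those of degree larger than `4` are automatically zero). -/
abbrev MixedForm : Type := (n : ℕ) → Phase [⋀^Fin n]→L[ℝ] ℂ

/-- A complex `n`-covector as a form of mixed degree. -/
def ofDegree (n : ℕ) (a : Phase [⋀^Fin n]→L[ℝ] ℂ) : MixedForm := Pi.single n a

/-- A real `n`-covector as a complex form of mixed degree. -/
def ofReal {n : ℕ} (a : Phase [⋀^Fin n]→L[ℝ] ℝ) : MixedForm :=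
  ofDegree n (Complex.ofRealCLM.compContinuousAlternatingMap a)

/-- A complex number as a form of degree `0`. -/
def scalar (c : ℂ) : MixedForm :=
  ofDegree 0 (ContinuousAlternatingMap.constOfIsEmpty ℝ Phase (Fin 0) c)

/-- The exterior product of forms of mixed degree. -/
def mwedge (a b : MixedForm) : MixedForm := fun n =>
  ∑ pq ∈ (Finset.HasAntidiagonal.antidiagonal n).attach,
    wedge (Finset.HasAntidiagonal.mem_antidiagonal.1 pq.2) (a pq.1.1) (b pq.1.2)

/-- A complex form of mixed degree is real when it takes real values on real vectors. -/
def IsReal (θ : MixedForm) : Prop := ∀ n v, (θ n v).im = 0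

/-- The real part of a complex form of mixed degree. -/
def rePart (θ : MixedForm) : MixedForm := fun n =>
  (Complex.ofRealCLM.comp Complex.reCLM).compContinuousAlternatingMap (θ n)

/-- The exterior derivative of a differential form of mixed degree. -/
def mextDeriv (F : Phase → MixedForm) (x : Phase) : MixedForm
  | 0 => 0
  | n + 1 => extDeriv (fun y => F y n) x

/-! ### The generalized complex structure

In this section `σ` is the value at a point of the `2`-form `ω`. -/

/-- `T*` at a point. -/
abbrev Covec : Type := Phase →L[ℝ] ℝ

/-- The map `T → T*`, `X ↦ ι_X σ = σ(X, ·)`. -/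
def flat (σ : Phase [⋀^Fin 2]→L[ℝ] ℝ) : Phase →ₗ[ℝ] Covec where
  toFun X := (ContinuousAlternatingMap.ofSubsingleton ℝ Phase ℝ (0 : Fin 1)).symm (σ.curryLeft X)
  map_add' X Y := by ext Z; simp [ContinuousAlternatingMap.ofSubsingleton]
  map_smul' c X := by ext Z; simp [ContinuousAlternatingMap.ofSubsingleton]

theorem flat_apply (σ : Phase [⋀^Fin 2]→L[ℝ] ℝ) (X Y : Phase) : flat σ X Y = σ ![X, Y] := by
  simp only [flat, LinearMap.coe_mk, AddHom.coe_mk]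
  change σ _ = _
  congr 1
  ext i
  fin_cases i <;> rfl

/-- The inverse `Ω⁻¹ : T* → T` of `X ↦ ι_X Ω`, in coordinates. -/
def sharp : Covec →ₗ[ℝ] Phase where
  toFun ξ := ![ξ (coordVec 2), ξ (coordVec 3), -ξ (coordVec 0), -ξ (coordVec 1)]
  map_add' ξ η := by ext i; fin_cases i <;> simp <;> ring
  map_smul' c ξ := by ext i; fin_cases i <;> simp

theorem wedge_coordForm (i j : Fin 4) (X Y : Phase) :
    wedge (n := 2) rfl (coordForm i) (coordForm j) ![X, Y] = X i * Y j - Y i * X j := by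
  have h1 : ∀ (k : Fin 4) (v : Fin 1 → Phase), coordForm k v = v 0 k := fun _ _ => rfl
  have hu : (Finset.univ : Finset (Equiv.Perm (Fin 2))) = {1, Equiv.swap 0 1} := by decide
  have hn : (1 : Equiv.Perm (Fin 2)) ≠ Equiv.swap 0 1 := by decide
  have h2 : wedge (n := 2) rfl (coordForm i) (coordForm j) ![X, Y] =
      ((Nat.factorial 1 * Nat.factorial 1 : ℝ)⁻¹) * ∑ τ : Equiv.Perm (Fin 2), Equiv.Perm.sign τ •
        concatProd (p := 1) (q := 1) rfl (coordForm i) (coordForm j) (![X, Y] ∘ τ) := by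
    simp [wedge, ContinuousMultilinearMap.alternatization_apply_apply]
  rw [h2, hu, Finset.sum_pair hn]
  simp [concatProd_apply, h1]
  ring

theorem Omega_apply (X Y : Phase) :
    Omega ![X, Y] = X 0 * Y 2 - X 2 * Y 0 + (X 1 * Y 3 - X 3 * Y 1) := by
  rw [Omega, ContinuousAlternatingMap.add_apply, wedge_coordForm, wedge_coordForm]
  ring

/-- `sharp` is the inverse of `X ↦ ι_X Ω`. -/
theorem sharp_flat (X : Phase) : sharp (flat Omega X) = X := by
  ext i; fin_cases i <;> simp [sharp, flat_apply, Omega_apply, coordVec]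

theorem flat_sharp (ξ : Covec) : flat Omega (sharp ξ) = ξ := by
  ext Y
  have h : ξ Y = ∑ i, Y i * ξ (coordVec i) := by
    conv_lhs => rw [← Finset.univ_sum_single Y]
    rw [map_sum]
    refine Finset.sum_congr rfl fun i _ => ?_
    rw [← smul_eq_mul, ← map_smul]
    congr 1
    ext j
    simp [coordVec, Pi.single_apply]
  rw [flat_apply, Omega_apply, h, Fin.sum_univ_four]
  simp [sharp]
  ring

/-- The tensor `A` defined by `ω = Ω(A·, ·)`. -/
def tensorA (σ : Phase [⋀^Fin 2]→L[ℝ] ℝ) : Phase →ₗ[ℝ] Phase := sharp ∘ₗ flat σ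

/-- The defining property of `A`. -/
theorem tensorA_spec (σ : Phase [⋀^Fin 2]→L[ℝ] ℝ) (X Y : Phase) :
    Omega ![tensorA σ X, Y] = σ ![X, Y] := by
  rw [← flat_apply, ← flat_apply, tensorA, LinearMap.comp_apply, flat_sharp]

/-- `T ⊕ T*` at a point. -/
abbrev GenTangent : Type := Phase × Covec

/-- The generalized complex structure of the Hitchin pair `(ω, Ω)`,
`𝕁 (X + ξ) = (A X + Ω⁻¹ ξ) + (ω̃ X - A* ξ)` with `ω̃ = -Ω((1 + A²)·, ·)`. -/
def genJ (σ : Phase [⋀^Fin 2]→L[ℝ] ℝ) : GenTangent →ₗ[ℝ] GenTangent where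
  toFun u :=
    (tensorA σ u.1 + sharp u.2,
      -flat Omega (u.1 + tensorA σ (tensorA σ u.1))
        - u.2.comp (LinearMap.toContinuousLinearMap (tensorA σ)))
  map_add' u v := by
    ext i
    · simp; ring
    · simp; ring
  map_smul' c u := by
    ext i
    · simp
    · simp; ring

/-- The `-i`-eigenspace `Ē = Ker (𝕁 + i)` of `𝕁` in `(T ⊕ T*) ⊗ ℂ`. -/
def eigenBar (σ : Phase [⋀^Fin 2]→L[ℝ] ℝ) : Submodule ℂ (TensorProduct ℝ ℂ GenTangent) :=
  LinearMap.ker ((genJ σ).baseChange ℂ + Complex.I • LinearMap.id)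

/-! ### The spin representation and Gualtieri's decomposition -/

/-- The form `ι_X θ + ξ ∧ θ`, for `u = X + ξ`. The exterior product with the `1`-covector `ξ` is
`(ξ ∧ θ)(v₀, …, v_m) = ∑ i, (-1) ^ i * ξ(v_i) * θ(v₀, …, v̂_i, …, v_m)`. -/
def spinFun (u : GenTangent) (θ : MixedForm) : MixedForm
  | 0 => (θ 1).curryLeft u.1
  | m + 1 => (θ (m + 2)).curryLeft u.1 +
      ContinuousAlternatingMap.alternatizeUncurryFin (u.2.smulRight (θ m))

/-- The action `ρ(X + ξ) θ = ι_X θ + ξ ∧ θ` of `T ⊕ T*` on complex forms. -/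
def spinReal : GenTangent →ₗ[ℝ] MixedForm →ₗ[ℂ] MixedForm :=
  LinearMap.mk₂' ℝ ℂ spinFun
    (by
      intro u v θ; funext n
      cases n with
      | zero => simp [spinFun]
      | succ m =>
        ext w
        simp [spinFun, ContinuousAlternatingMap.alternatizeUncurryFin_apply, add_mul, smul_add,
          Finset.sum_add_distrib]
        ring)
    (by
      intro c u θ; funext n
      cases n with
      | zero => simp [spinFun]
      | succ m =>
        ext w
        simp [spinFun, ContinuousAlternatingMap.alternatizeUncurryFin_apply, Finset.mul_sum]
        exact Finset.sum_congr rfl fun i _ => by ring)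
    (by
      intro u θ η; funext n
      cases n with
      | zero => ext w; simp [spinFun]
      | succ m =>
        ext w
        simp [spinFun, ContinuousAlternatingMap.alternatizeUncurryFin_apply, smul_add,
          Finset.sum_add_distrib]
        ring)
    (by
      intro c u θ; funext n
      cases n with
      | zero => ext w; simp [spinFun]
      | succ m =>
        ext w
        simp [spinFun, ContinuousAlternatingMap.alternatizeUncurryFin_apply, Finset.mul_sum]
        exact Finset.sum_congr rfl fun i _ => by ring)

/-- The complex-linear extension of `ρ` to `(T ⊕ T*) ⊗ ℂ`. -/
def spin : TensorProduct ℝ ℂ GenTangent →ₗ[ℂ] MixedForm →ₗ[ℂ] MixedForm :=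
  LinearMap.liftBaseChange ℂ spinReal

/-- `Θ = ω - i Ω`. -/
def Theta (σ : Phase [⋀^Fin 2]→L[ℝ] ℝ) : MixedForm := ofReal σ - Complex.I • ofReal Omega

/-- `Φ = exp Θ = 1 + Θ + Θ² / 2` (the higher powers of `Θ` vanish in dimension `4`). -/
def Phi (σ : Phase [⋀^Fin 2]→L[ℝ] ℝ) : MixedForm :=
  scalar 1 + Theta σ + (1 / 2 : ℂ) • mwedge (Theta σ) (Theta σ)

/-- The space `U_k = ρ(Λ^{2-k} Ē)(Φ)`. As `Ē` is isotropic for the pairing of `T ⊕ T*`, the elements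
of `Ē` anticommute in the Clifford algebra, so that the image of `Λ^j Ē` is spanned by
the products `ρ(e₁) ⋯ ρ(e_j)` with `e₁, …, e_j ∈ Ē`. -/
def gualtieriU (σ : Phase [⋀^Fin 2]→L[ℝ] ℝ) (k : ℤ) : Submodule ℂ MixedForm :=
  Submodule.span ℂ {θ | ∃ l : List (TensorProduct ℝ ℂ GenTangent),
    (∀ e ∈ l, e ∈ eigenBar σ) ∧ (l.length : ℤ) = 2 - k ∧
      θ = l.foldr (fun e η => spin e η) (Phi σ)}

open Classical in
/-- The projection `π_k` onto `U_k` in `Λ*(T*) ⊗ ℂ = U_{-2} ⊕ U_{-1} ⊕ U_0 ⊕ U_1 ⊕ U_2`: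
the `U_k`-component in the decomposition of a form as a sum of elements of the spaces `U_j`. -/
def proj (σ : Phase [⋀^Fin 2]→L[ℝ] ℝ) (k : ℤ) (θ : MixedForm) : MixedForm :=
  if h : ∃ u : ℤ → MixedForm, (∀ j, u j ∈ gualtieriU σ j) ∧
      ∑ j ∈ Finset.Icc (-2 : ℤ) 2, u j = θ
  then h.choose k else 0

/-- The operator `∂̄ = π_{k+1} ∘ d` on sections of `U_k`. -/
def delBar (ω : Phase → Phase [⋀^Fin 2]→L[ℝ] ℝ) (k : ℤ) (F : Phase → MixedForm) :
    Phase → MixedForm :=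
  fun x => proj (ω x) (k + 1) (mextDeriv F x)

/-- The operator `∂ = π_{k-1} ∘ d` on sections of `U_k`. -/
def del (ω : Phase → Phase [⋀^Fin 2]→L[ℝ] ℝ) (k : ℤ) (F : Phase → MixedForm) :
    Phase → MixedForm :=
  fun x => proj (ω x) (k - 1) (mextDeriv F x)

/-- `U = ω ∧ Φ`. -/
def formU (ω : Phase → Phase [⋀^Fin 2]→L[ℝ] ℝ) (x : Phase) : MixedForm :=
  mwedge (ofReal (ω x)) (Phi (ω x))

/-- `V = (i Ω + 1) ∧ Φ`. -/
def formV (ω : Phase → Phase [⋀^Fin 2]→L[ℝ] ℝ) (x : Phase) : MixedForm :=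
  mwedge (Complex.I • ofReal Omega + scalar 1) (Phi (ω x))

/-- The form `f U + c g V`, for real functions `f`, `g` and a complex constant `c`. -/
def combUV (ω : Phase → Phase [⋀^Fin 2]→L[ℝ] ℝ) (c : ℂ) (f g : Phase → ℝ) (x : Phase) :
    MixedForm :=
  (f x : ℂ) • formU ω x + (c * (g x : ℂ)) • formV ω x

/-- The differential `df` of a real function, as a form of mixed degree. -/
def dfun (f : Phase → ℝ) : Phase → MixedForm := mextDeriv fun y => scalar (f y)

/-- The form `df ∧ ω + dg ∧ Ω`. -/
def pairForm (ω : Phase → Phase [⋀^Fin 2]→L[ℝ] ℝ) (f g : Phase → ℝ) (x : Phase) : MixedForm :=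
  mwedge (dfun f x) (ofReal (ω x)) + mwedge (dfun g x) (ofReal Omega)

end MongeAmpere

end

/-! Put β = ω + iΩ. The bundle Ē consists of the elements X - ι_X β with X complex, and such an
element acts on forms as e^β ι_X e^{-β}. After untwisting by e^{-β}, the spinor Φ becomes exp(-2iΩ)
and Ē acts by contraction. Hence U_1 is the space of forms ξ ∧ exp(ω - iΩ) and U_{-1} that of forms
ξ ∧ exp(ω + iΩ), with ξ a complex 1-covector, while U_{-2}, U_0 and U_2 consist of forms of even
degree. Since wedging with Ω is an isomorphism from 1-covectors to 3-covectors in dimension 4, every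
odd form is uniquely a sum of elements of U_1 and U_{-1} (`exists_odd_decomposition`,
`oddExpSpace_inf_eq_zero`, `proj_odd`).

Expanding the exponential gives U = ω + ω² and V = 1 + ω + (ω² + Ω²)/2, where primitivity removes
the imaginary part of U. For c = ±i, closedness of ω gives d(fU + cgV) = c dg + (df + c dg) ∧ ω. As
c² = -1, subtracting η = df ∧ ω + dg ∧ Ω leaves c dg ∧ exp(ω + cΩ), which lies in U_{-1} for c = i
and in U_1 for c = -i (`mextDeriv_combUV_sub_pairForm_mem`). The projection in ∂̄, respectively ∂,
kills this remainder and only the component of η survives.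

The form η is real without part of degree 1, so its two components are complex conjugate, and η is
the real part of twice either one (`rePart_two_smul`). Each component therefore vanishes exactly
when η does. Finally η = d(fω + gΩ), and on ℝ⁴ closed forms are exact by the Poincaré lemma. -/

noncomputable section

namespace MongeAmpere

/-! ### The Poincaré lemma on a finite-dimensional space. -/

section Poincare

open MeasureTheory intervalIntegral Set

universe u

variable {E F : Type u} [NormedAddCommGroup E] [NormedSpace ℝ E] 
  [NormedAddCommGroup F] [NormedSpace ℝ F]

/-- Differentiation under the integral sign: the continuous derivative is bounded on the product of
a closed ball, compact as `E` is proper, with [0, 1], and this bound dominates. -/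
theorem hasFDerivAt_parametric_integral [ProperSpace E] {H : E × ℝ → F} (hH : ContDiff ℝ 1 H) (x₀ : E) :
    HasFDerivAt (fun x => ∫ t in (0 : ℝ)..1, H (x, t))
      (∫ t in (0 : ℝ)..1, (fderiv ℝ H (x₀, t)).comp (ContinuousLinearMap.inl ℝ E ℝ)) x₀ := by
  have hc : Continuous H := hH.continuous
  have hd : Continuous fun p : E × ℝ =>
      (fderiv ℝ H p).comp (ContinuousLinearMap.inl ℝ E ℝ) :=
    (hH.continuous_fderiv one_ne_zero).clm_comp continuous_const
  obtain ⟨C, hC⟩ := ((isCompact_closedBall x₀ 1).prod (isCompact_Icc (a := (0 : ℝ)) (b := 1)))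
    |>.exists_bound_of_continuousOn hd.continuousOn
  refine intervalIntegral.hasFDerivAt_integral_of_dominated_of_fderiv_le
    (F := fun x t => H (x, t)) (s := Metric.closedBall x₀ 1) (bound := fun _ => C)
    (F' := fun x t => (fderiv ℝ H (x, t)).comp (ContinuousLinearMap.inl ℝ E ℝ))
    (Metric.closedBall_mem_nhds x₀ one_pos) ?_ ?_ ?_ ?_ ?_ ?_
  · exact Filter.Eventually.of_forall fun x => (hc.comp (by fun_prop)).aestronglyMeasurable
  · exact (hc.comp (by fun_prop : Continuous fun t : ℝ => (x₀, t))).intervalIntegrable _ _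
  · exact (hd.comp (by fun_prop : Continuous fun t : ℝ => (x₀, t))).aestronglyMeasurable
  · refine Filter.Eventually.of_forall fun t ht x hx => hC (x, t) ⟨hx, ?_⟩
    rw [uIoc_of_le zero_le_one] at ht
    exact Ioc_subset_Icc_self ht
  · exact intervalIntegrable_const
  · refine Filter.Eventually.of_forall fun t _ x _ => ?_
    have h1 : HasFDerivAt H (fderiv ℝ H (x, t)) (x, t) :=
      (hH.differentiable one_ne_zero _).hasFDerivAt
    exact h1.comp x (hasFDerivAt_prodMk_left x t)

/-- The derivative is again an integral of this kind, with values in `E →L[ℝ] F`. This is why the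
induction varies `F`, and why `E` and `F` share a universe. -/
theorem contDiff_parametric_integral_nat [ProperSpace E] (n : ℕ) {H : E × ℝ → F}
    (hH : ContDiff ℝ ((⊤ : ℕ∞) : WithTop ℕ∞) H) :
    ContDiff ℝ n (fun x => ∫ t in (0 : ℝ)..1, H (x, t)) := by
  induction n generalizing F with
  | zero =>
    exact contDiff_zero.2 (continuous_iff_continuousAt.2 fun x =>
      (hasFDerivAt_parametric_integral (hH.of_le (by exact_mod_cast le_top)) x).continuousAt)
  | succ n ih =>
    have hd := hasFDerivAt_parametric_integral (hH.of_le (by exact_mod_cast le_top) : ContDiff ℝ 1 H)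
    push_cast
    refine (contDiff_succ_iff_hasFDerivAt (n := n)).2 ⟨_, ?_, hd⟩
    refine ih (H := fun p => (fderiv ℝ H p).comp (ContinuousLinearMap.inl ℝ E ℝ)) ?_
    exact (hH.fderiv_right (by simp)).clm_comp contDiff_const

theorem contDiff_parametric_integral [ProperSpace E] {H : E × ℝ → F}
    (hH : ContDiff ℝ ((⊤ : ℕ∞) : WithTop ℕ∞) H) :
    ContDiff ℝ ((⊤ : ℕ∞) : WithTop ℕ∞) (fun x => ∫ t in (0 : ℝ)..1, H (x, t)) :=
  contDiff_infty.2 fun n => contDiff_parametric_integral_nat n hH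

open ContinuousAlternatingMap in
/-- The algebraic part of the homotopy formula: contraction anticommutes with the
antisymmetrisation of a covector-valued form that has vanishing antisymmetrisation. -/
theorem alternatizeUncurryFin_flip_curryLeft {n : ℕ} (T : E →L[ℝ] E [⋀^Fin (n + 1)]→L[ℝ] F)
    (hT : alternatizeUncurryFin T = 0) (x : E) (T' : E →L[ℝ] E [⋀^Fin n]→L[ℝ] F)
    (hT' : ∀ y, T' y = (T y).curryLeft x) : alternatizeUncurryFin T' = T x := by
  ext v
  -- On (x, v), the term of index 0 is T x v and the others add up to minus the antisymmetrisation
  -- of T' at v.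
  have h : alternatizeUncurryFin T (Matrix.vecCons x v) = 0 := by rw [hT]; rfl
  rw [alternatizeUncurryFin_apply, Fin.sum_univ_succ] at h
  rw [alternatizeUncurryFin_apply]
  have h2 : ∀ i : Fin (n + 1), Fin.removeNth i.succ (Matrix.vecCons x v)
      = Matrix.vecCons x (Fin.removeNth i v) := by
    intro i
    ext j
    refine Fin.cases ?_ (fun j => ?_) j
    · simp [Fin.removeNth]
    · simp [Fin.removeNth]
  have h3 : Fin.removeNth 0 (Matrix.vecCons x v) = v := by
    ext j; simp [Fin.removeNth]
  simp only [h2, h3, hT', curryLeft_apply_apply, Matrix.cons_val_zero, Matrix.cons_val_succ,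
    Fin.val_zero, pow_zero, one_smul, Fin.val_succ, pow_succ, mul_neg, mul_one, neg_smul,
    Finset.sum_neg_distrib] at h ⊢
  exact (add_neg_eq_zero.1 h).symm

/-- The analytic part of the homotopy formula, for an abstract contraction `C` and
antisymmetrisation `L`. -/
theorem homotopy_operator [ProperSpace E] {G : Type u} [NormedAddCommGroup G] [NormedSpace ℝ G]
    [CompleteSpace F] [CompleteSpace G]
    (C : G →L[ℝ] E →L[ℝ] F) (L : (E →L[ℝ] F) →L[ℝ] G) (n : ℕ) (β : E → G)
    (hβ : ContDiff ℝ ((⊤ : ℕ∞) : WithTop ℕ∞) β)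
    (hL : ∀ (x : E) (t : ℝ), L ((C.comp (t • fderiv ℝ β (t • x))).flip x + C (β (t • x))) =
      t • fderiv ℝ β (t • x) x + (n + 1) • β (t • x)) :
    ∃ α : E → F, ContDiff ℝ ((⊤ : ℕ∞) : WithTop ℕ∞) α ∧ ∀ x, L (fderiv ℝ α x) = β x := by
  -- The cone operator: integrate t^n ι_x β(tx). The weight t^n makes the integrand, after applying
  -- L to the derivative, equal to d/dt (t^{n+1} β(tx)), whose boundary term at 0 vanishes.
  let H : E × ℝ → F := fun p => p.2 ^ n • C (β (p.2 • p.1)) p.1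
  have hH : ContDiff ℝ ((⊤ : ℕ∞) : WithTop ℕ∞) H := by
    refine (contDiff_snd.pow n).smul (ContDiff.clm_apply ?_ contDiff_fst)
    exact C.contDiff.comp (hβ.comp (contDiff_snd.smul contDiff_fst))
  have hH1 : ContDiff ℝ 1 H := hH.of_le (by exact_mod_cast le_top)
  refine ⟨fun x => ∫ t in (0 : ℝ)..1, H (x, t), contDiff_parametric_integral hH, fun x => ?_⟩
  have hβd : ∀ y, HasFDerivAt β (fderiv ℝ β y) y := fun y =>
    (hβ.differentiable (by simp) y).hasFDerivAt
  have hder : ∀ t, (fderiv ℝ H (x, t)).comp (ContinuousLinearMap.inl ℝ E ℝ) =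
      t ^ n • ((C.comp (t • fderiv ℝ β (t • x))).flip x + C (β (t • x))) := by
    intro t
    have h1 : HasFDerivAt (fun y => H (y, t))
        ((fderiv ℝ H (x, t)).comp (ContinuousLinearMap.inl ℝ E ℝ)) x :=
      (hH1.differentiable one_ne_zero _).hasFDerivAt.comp x (hasFDerivAt_prodMk_left x t)
    have h2 : HasFDerivAt (fun y : E => β (t • y)) (t • fderiv ℝ β (t • x)) x := by
      refine ((hβd (t • x)).comp x ((hasFDerivAt_id x).const_smul t)).congr_fderiv ?_
      ext; simp
    have h3 : HasFDerivAt (fun y => H (y, t))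
        (t ^ n • ((C.comp (t • fderiv ℝ β (t • x))).flip x + C (β (t • x)))) x := by
      refine (((C.hasFDerivAt.comp x h2).clm_apply
        (hasFDerivAt_id x)).const_smul (t ^ n)).congr_fderiv ?_
      ext; simp [add_comm]
    exact h1.unique h3
  have hcont : Continuous fun t : ℝ =>
      (fderiv ℝ H (x, t)).comp (ContinuousLinearMap.inl ℝ E ℝ) :=
    ((hH1.continuous_fderiv one_ne_zero).comp (by fun_prop)).clm_comp continuous_const
  have hprim : ∀ t : ℝ, HasDerivAt (fun t : ℝ => t ^ (n + 1) • β (t • x))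
      (L ((fderiv ℝ H (x, t)).comp (ContinuousLinearMap.inl ℝ E ℝ))) t := by
    intro t
    have h1 : HasDerivAt (fun t : ℝ => β (t • x)) (fderiv ℝ β (t • x) x) t := by
      have h0 : HasDerivAt (fun t : ℝ => t • x) x t := by
        simpa using (hasDerivAt_id t).smul_const x
      exact (hβd (t • x)).comp_hasDerivAt t h0
    refine ((hasDerivAt_pow (n + 1) t).smul h1).congr_deriv ?_
    rw [hder, map_smul, hL, smul_add, smul_smul, ← pow_succ, ← Nat.cast_smul_eq_nsmul ℝ,
      smul_smul, mul_comm (t ^ n)]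
    simp
  rw [(hasFDerivAt_parametric_integral hH1 x).fderiv,
    ← ContinuousLinearMap.intervalIntegral_comp_comm _ (hcont.intervalIntegrable _ _),
    integral_eq_sub_of_hasDerivAt (fun t _ => hprim t)
      ((L.continuous.comp hcont).intervalIntegrable _ _)]
  simp

open ContinuousAlternatingMap in
/-- The Poincaré lemma for forms of positive degree on a whole space. -/
theorem exists_extDeriv_eq_of_extDeriv_eq_zero [ProperSpace E] [CompleteSpace F] {n : ℕ}
    (β : E → E [⋀^Fin (n + 1)]→L[ℝ] F) (hβ : ContDiff ℝ ((⊤ : ℕ∞) : WithTop ℕ∞) β)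
    (hd : ∀ x, extDeriv β x = 0) :
    ∃ α : E → E [⋀^Fin n]→L[ℝ] F, ContDiff ℝ ((⊤ : ℕ∞) : WithTop ℕ∞) α ∧
      ∀ x, extDeriv α x = β x := by
  refine homotopy_operator curryLeftLI.toContinuousLinearMap (alternatizeUncurryFinCLM ℝ E F) n β
    hβ fun x t => ?_
  rw [map_add]
  congr 1
  -- The term where β is differentiated: closedness at the point t • x is used here.
  · exact alternatizeUncurryFin_flip_curryLeft (t • fderiv ℝ β (t • x))
      (by rw [alternatizeUncurryFin_smul]; exact (congrArg _ (hd (t • x))).trans (smul_zero t))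
      x _ fun y => rfl
  -- Antisymmetrising the contraction of an (n+1)-form reproduces it n+1 times.
  · exact alternatizeUncurryFin_curryLeft _

end Poincare

/-! ### Explicit exterior products in low degree. -/

section WedgeFormulas

variable {𝔸 : Type*} [NormedCommRing 𝔸] [NormedAlgebra ℝ 𝔸]

theorem wedge_apply {p q n : ℕ} (h : p + q = n) (a : Phase [⋀^Fin p]→L[ℝ] 𝔸)
    (b : Phase [⋀^Fin q]→L[ℝ] 𝔸) (v : Fin n → Phase) :
    wedge h a b v = ((p.factorial * q.factorial : ℝ)⁻¹) • ∑ τ : Equiv.Perm (Fin n),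
      Equiv.Perm.sign τ • (a (fun i => v (τ (Fin.cast h (Fin.castAdd q i)))) *
        b (fun j => v (τ (Fin.cast h (Fin.natAdd p j))))) := by
  simp [wedge, ContinuousMultilinearMap.alternatization_apply_apply, concatProd_apply]

/-- All q! permutations contribute the same term, the sign cancelling that of the reordering; this
absorbs the factor 1/q!. -/
theorem wedge_scalar_left {q n : ℕ} (h : 0 + q = n) (c : 𝔸) (b : Phase [⋀^Fin q]→L[ℝ] 𝔸)
    (v : Fin n → Phase) :
    wedge h (ContinuousAlternatingMap.constOfIsEmpty ℝ Phase (Fin 0) c) b v =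
      c * b (fun j => v (Fin.cast (by omega) j)) := by
  obtain rfl : q = n := by omega
  have h1 : ∀ τ : Equiv.Perm (Fin q), Equiv.Perm.sign τ •
      (c * b (fun j => v (τ (Fin.cast h (Fin.natAdd 0 j))))) = c * b v := by
    intro τ
    have h2 : (fun j => v (τ (Fin.cast h (Fin.natAdd 0 j)))) = v ∘ τ := by
      ext j : 1
      simp
    have h3 : b (v ∘ τ) = Equiv.Perm.sign τ • b v := b.toAlternatingMap.map_perm v τ
    rw [h2, h3, mul_smul_comm, smul_smul]
    simp
  rw [wedge_apply]
  simp only [ContinuousAlternatingMap.constOfIsEmpty_apply, h1]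
  have hq : (q.factorial : ℝ) ≠ 0 := by exact_mod_cast q.factorial_ne_zero
  rw [Finset.sum_const, Finset.card_univ, Fintype.card_perm, Fintype.card_fin,
    ← Nat.cast_smul_eq_nsmul ℝ, smul_smul]
  simp [hq]

theorem wedge_scalar_right {p n : ℕ} (h : p + 0 = n) (c : 𝔸) (a : Phase [⋀^Fin p]→L[ℝ] 𝔸)
    (v : Fin n → Phase) :
    wedge h a (ContinuousAlternatingMap.constOfIsEmpty ℝ Phase (Fin 0) c) v =
      a (fun j => v (Fin.cast (by omega) j)) * c := by
  obtain rfl : p = n := by omega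
  have h1 : ∀ τ : Equiv.Perm (Fin p), Equiv.Perm.sign τ •
      (a (fun j => v (τ (Fin.cast h (Fin.castAdd 0 j)))) * c) = a v * c := by
    intro τ
    have h3 : a (v ∘ τ) = Equiv.Perm.sign τ • a v := a.toAlternatingMap.map_perm v τ
    change Equiv.Perm.sign τ • (a (v ∘ τ) * c) = _
    rw [h3, smul_mul_assoc, smul_smul]
    simp
  rw [wedge_apply]
  simp only [ContinuousAlternatingMap.constOfIsEmpty_apply, h1]
  have hq : (p.factorial : ℝ) ≠ 0 := by exact_mod_cast p.factorial_ne_zero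
  rw [Finset.sum_const, Finset.card_univ, Fintype.card_perm, Fintype.card_fin,
    ← Nat.cast_smul_eq_nsmul ℝ, smul_smul]
  simp [hq]

/-- Iterated, this splits permutations by the image of 0, so that sums over permutations of `Fin 3`
and `Fin 4` can be written out. -/
theorem sum_perm_fin_succ {n : ℕ} {A : Type*} [AddCommMonoid A]
    (F : Equiv.Perm (Fin (n + 1)) → A) :
    ∑ τ, F τ = ∑ i, ∑ τ, F (Equiv.Perm.decomposeFin.symm (i, τ)) := by
  rw [← Equiv.Perm.decomposeFin.symm.sum_comp, Fintype.sum_prod_type]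

theorem alternating_two_swap (a : Phase [⋀^Fin 2]→L[ℝ] 𝔸) (X Y : Phase) :
    a ![X, Y] = -a ![Y, X] := by
  have := a.toAlternatingMap.map_swap ![Y, X] (i := 0) (j := 1) (by decide)
  rw [← ContinuousAlternatingMap.coe_toAlternatingMap, ← this]
  congr 1
  ext i : 1
  fin_cases i <;> rfl

theorem wedge_one_two (a : Phase [⋀^Fin 1]→L[ℝ] 𝔸) (b : Phase [⋀^Fin 2]→L[ℝ] 𝔸)
    (X Y Z : Phase) :
    wedge (n := 3) rfl a b ![X, Y, Z] =
      a ![X] * b ![Y, Z] - a ![Y] * b ![X, Z] + a ![Z] * b ![X, Y] := by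
  have h1 : ∀ (v : Fin 3 → Phase) (τ : Equiv.Perm (Fin 3)),
      a (fun i => v (τ (Fin.cast rfl (Fin.castAdd 2 i)))) = a ![v (τ 0)] := fun v τ => by
    congr 1; ext i : 1; fin_cases i; rfl
  have h2 : ∀ (v : Fin 3 → Phase) (τ : Equiv.Perm (Fin 3)),
      b (fun i => v (τ (Fin.cast rfl (Fin.natAdd 1 i)))) = b ![v (τ 1), v (τ 2)] := fun v τ => by
    congr 1; ext i : 1; fin_cases i <;> rfl
  have d1 : ∀ i (τ : Equiv.Perm (Fin 2)), Equiv.Perm.decomposeFin.symm (i, τ) 1 =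
    Equiv.swap 0 i (τ 0).succ := fun i τ => Equiv.Perm.decomposeFin_symm_apply_succ τ i 0
  have d2 : ∀ i (τ : Equiv.Perm (Fin 2)), Equiv.Perm.decomposeFin.symm (i, τ) 2 =
    Equiv.swap 0 i (τ 1).succ := fun i τ => Equiv.Perm.decomposeFin_symm_apply_succ τ i 1
  have d3 : ∀ i (τ : Equiv.Perm (Fin 1)), Equiv.Perm.decomposeFin.symm (i, τ) 1 =
    Equiv.swap 0 i (τ 0).succ := fun i τ => Equiv.Perm.decomposeFin_symm_apply_succ τ i 0
  rw [wedge_apply]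
  simp only [h1, h2, sum_perm_fin_succ, Equiv.Perm.decomposeFin_symm_apply_zero, d1, d2, d3,
    Equiv.Perm.decomposeFin.symm_sign]
  simp [Fin.sum_univ_succ, Equiv.swap_apply_def]
  rw [alternating_two_swap b Z Y, alternating_two_swap b Z X, alternating_two_swap b Y X]
  simp only [mul_neg]
  module

/-- The 24 permutations form six shuffles of four equal terms each, which cancels 1/(2! 2!). -/
theorem wedge_two_two (a b : Phase [⋀^Fin 2]→L[ℝ] 𝔸)
    (X Y Z W : Phase) :
    wedge (n := 4) rfl a b ![X, Y, Z, W] =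
      a ![X, Y] * b ![Z, W] - a ![X, Z] * b ![Y, W] + a ![X, W] * b ![Y, Z] +
      a ![Y, Z] * b ![X, W] - a ![Y, W] * b ![X, Z] + a ![Z, W] * b ![X, Y] := by
  have h1 : ∀ (v : Fin 4 → Phase) (τ : Equiv.Perm (Fin 4)),
      a (fun i => v (τ (Fin.cast rfl (Fin.castAdd 2 i)))) = a ![v (τ 0), v (τ 1)] := fun v τ => by
    congr 1; ext i : 1; fin_cases i <;> rfl
  have h2 : ∀ (v : Fin 4 → Phase) (τ : Equiv.Perm (Fin 4)),
      b (fun i => v (τ (Fin.cast rfl (Fin.natAdd 2 i)))) = b ![v (τ 2), v (τ 3)] := fun v τ => by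
    congr 1; ext i : 1; fin_cases i <;> rfl
  have c1 : ∀ i (τ : Equiv.Perm (Fin 3)), Equiv.Perm.decomposeFin.symm (i, τ) 1 =
    Equiv.swap 0 i (τ 0).succ := fun i τ => Equiv.Perm.decomposeFin_symm_apply_succ τ i 0
  have c2 : ∀ i (τ : Equiv.Perm (Fin 3)), Equiv.Perm.decomposeFin.symm (i, τ) 2 =
    Equiv.swap 0 i (τ 1).succ := fun i τ => Equiv.Perm.decomposeFin_symm_apply_succ τ i 1
  have c3 : ∀ i (τ : Equiv.Perm (Fin 3)), Equiv.Perm.decomposeFin.symm (i, τ) 3 =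
    Equiv.swap 0 i (τ 2).succ := fun i τ => Equiv.Perm.decomposeFin_symm_apply_succ τ i 2
  have d1 : ∀ i (τ : Equiv.Perm (Fin 2)), Equiv.Perm.decomposeFin.symm (i, τ) 1 =
    Equiv.swap 0 i (τ 0).succ := fun i τ => Equiv.Perm.decomposeFin_symm_apply_succ τ i 0
  have d2 : ∀ i (τ : Equiv.Perm (Fin 2)), Equiv.Perm.decomposeFin.symm (i, τ) 2 =
    Equiv.swap 0 i (τ 1).succ := fun i τ => Equiv.Perm.decomposeFin_symm_apply_succ τ i 1
  have d3 : ∀ i (τ : Equiv.Perm (Fin 1)), Equiv.Perm.decomposeFin.symm (i, τ) 1 =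
    Equiv.swap 0 i (τ 0).succ := fun i τ => Equiv.Perm.decomposeFin_symm_apply_succ τ i 0
  rw [wedge_apply]
  simp only [h1, h2, sum_perm_fin_succ, Equiv.Perm.decomposeFin_symm_apply_zero, c1, c2, c3, d1,
    d2, d3, Equiv.Perm.decomposeFin.symm_sign]
  simp [Fin.sum_univ_succ, Equiv.swap_apply_def]
  rw [alternating_two_swap b Z Y, alternating_two_swap b Z X, alternating_two_swap b Y X,
    alternating_two_swap b W X, alternating_two_swap b W Y, alternating_two_swap b W Z,
    alternating_two_swap a Z Y, alternating_two_swap a Z X, alternating_two_swap a Y X,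
    alternating_two_swap a W X, alternating_two_swap a W Y, alternating_two_swap a W Z]
  simp only [mul_neg, neg_mul]
  module

end WedgeFormulas

/-! ### Covectors in coordinates. -/

section Covectors

variable {𝔸 : Type*} [NormedAddCommGroup 𝔸] [NormedSpace ℝ 𝔸]

theorem vec_one_eta (v : Fin 1 → Phase) : v = ![v 0] := by
  ext i : 1; fin_cases i; rfl

theorem vec_two_eta (v : Fin 2 → Phase) : v = ![v 0, v 1] := by
  ext i : 1; fin_cases i <;> rfl

theorem vec_three_eta (v : Fin 3 → Phase) : v = ![v 0, v 1, v 2] := by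
  ext i : 1; fin_cases i <;> rfl

theorem vec_four_eta (v : Fin 4 → Phase) : v = ![v 0, v 1, v 2, v 3] := by
  ext i : 1; fin_cases i <;> rfl

/-- Covectors of degree larger than `4` vanish. -/
theorem alternating_eq_zero {n : ℕ} (hn : 5 ≤ n) (a : Phase [⋀^Fin n]→L[ℝ] 𝔸) : a = 0 := by
  ext v
  refine a.toAlternatingMap.map_linearDependent v fun hv => ?_
  have := hv.fintype_card_le_finrank
  simp at this
  omega

theorem covector_expand (a : Phase [⋀^Fin 1]→L[ℝ] 𝔸) (X : Phase) :
    a ![X] = X 0 • a ![coordVec 0] + X 1 • a ![coordVec 1] + X 2 • a ![coordVec 2] +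
      X 3 • a ![coordVec 3] := by
  obtain ⟨l, rfl⟩ := (ContinuousAlternatingMap.ofSubsingleton ℝ Phase 𝔸 (0 : Fin 1)).surjective a
  change l X = X 0 • l (coordVec 0) + X 1 • l (coordVec 1) + X 2 • l (coordVec 2) +
    X 3 • l (coordVec 3)
  rw [← map_smul, ← map_smul, ← map_smul, ← map_smul, ← map_add, ← map_add, ← map_add]
  congr 1
  ext i
  fin_cases i <;> simp [coordVec]

theorem alternating_two_expand {𝔸 : Type*} [NormedCommRing 𝔸] [NormedAlgebra ℝ 𝔸]
    (a : Phase [⋀^Fin 2]→L[ℝ] 𝔸) (X Y : Phase) :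
    a ![X, Y] = (X 0 * Y 1 - X 1 * Y 0) • a ![coordVec 0, coordVec 1] +
      (X 0 * Y 2 - X 2 * Y 0) • a ![coordVec 0, coordVec 2] +
      (X 0 * Y 3 - X 3 * Y 0) • a ![coordVec 0, coordVec 3] +
      (X 1 * Y 2 - X 2 * Y 1) • a ![coordVec 1, coordVec 2] +
      (X 1 * Y 3 - X 3 * Y 1) • a ![coordVec 1, coordVec 3] +
      (X 2 * Y 3 - X 3 * Y 2) • a ![coordVec 2, coordVec 3] := by
  have hl : ∀ Z W, a ![Z, W] = (a.curryLeft Z) ![W] := fun _ _ => rfl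
  have h0 : ∀ Z, a ![Z, Z] = 0 := fun Z =>
    a.toAlternatingMap.map_eq_zero_of_eq ![Z, Z] (i := 0) (j := 1) rfl (by decide)
  have h1 : ∀ Z W, a ![Z, W] = W 0 • a ![Z, coordVec 0] + W 1 • a ![Z, coordVec 1] +
      W 2 • a ![Z, coordVec 2] + W 3 • a ![Z, coordVec 3] := fun Z W => by
    rw [hl, covector_expand]; rfl
  have h2 : ∀ Z W, a ![Z, W] = Z 0 • a ![coordVec 0, W] + Z 1 • a ![coordVec 1, W] +
      Z 2 • a ![coordVec 2, W] + Z 3 • a ![coordVec 3, W] := fun Z W => by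
    rw [alternating_two_swap, h1, alternating_two_swap a W, alternating_two_swap a W,
      alternating_two_swap a W, alternating_two_swap a W]
    module
  rw [h2, h1 (coordVec 0), h1 (coordVec 1), h1 (coordVec 2), h1 (coordVec 3), h0, h0, h0, h0,
    alternating_two_swap a (coordVec 1) (coordVec 0),
    alternating_two_swap a (coordVec 2) (coordVec 0),
    alternating_two_swap a (coordVec 3) (coordVec 0),
    alternating_two_swap a (coordVec 2) (coordVec 1),
    alternating_two_swap a (coordVec 3) (coordVec 1),
    alternating_two_swap a (coordVec 3) (coordVec 2)]
  module

/-- Any injective triple of indices can be reordered into an increasing one, and there are only four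
of those. -/
theorem alternating_three_ext {a b : Phase [⋀^Fin 3]→L[ℝ] 𝔸}
    (h1 : a ![coordVec 0, coordVec 1, coordVec 2] = b ![coordVec 0, coordVec 1, coordVec 2])
    (h2 : a ![coordVec 0, coordVec 1, coordVec 3] = b ![coordVec 0, coordVec 1, coordVec 3])
    (h3 : a ![coordVec 0, coordVec 2, coordVec 3] = b ![coordVec 0, coordVec 2, coordVec 3])
    (h4 : a ![coordVec 1, coordVec 2, coordVec 3] = b ![coordVec 1, coordVec 2, coordVec 3]) :
    a = b := by
  have hs : ∀ v : Fin 3 → Fin 4, Function.Injective v → ∃ τ : Equiv.Perm (Fin 3),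
      v ∘ τ = ![0, 1, 2] ∨ v ∘ τ = ![0, 1, 3] ∨ v ∘ τ = ![0, 2, 3] ∨ v ∘ τ = ![1, 2, 3] := by
    decide
  apply ContinuousAlternatingMap.toAlternatingMap_injective
  refine (Pi.basisFun ℝ (Fin 4)).ext_alternating fun v hv => ?_
  obtain ⟨τ, hτ⟩ := hs v hv
  have hp : ∀ c : Phase [⋀^Fin 3]→L[ℝ] 𝔸, c (fun i => coordVec ((v ∘ τ) i)) =
      Equiv.Perm.sign τ • c (fun i => coordVec (v i)) := fun c =>
    c.toAlternatingMap.map_perm (fun i => coordVec (v i)) τ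
  have he : ∀ w : Fin 3 → Fin 4, (fun i => coordVec (w i)) =
      ![coordVec (w 0), coordVec (w 1), coordVec (w 2)] := fun w => vec_three_eta _
  have hb : (fun i => (Pi.basisFun ℝ (Fin 4)) (v i)) = fun i => coordVec (v i) := by
    ext i : 1; simp [coordVec]
  have key : a (fun i => coordVec ((v ∘ τ) i)) = b (fun i => coordVec ((v ∘ τ) i)) := by
    rcases hτ with h | h | h | h <;> rw [h, he] <;> assumption
  rw [hp, hp] at key
  change a _ = b _
  rw [hb]
  exact smul_left_cancel _ key

end Covectors

/-! ### Forms of mixed degree and the components of Φ. -/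

section MixedForms

theorem wedge_add_left {p q n : ℕ} (h : p + q = n) (a a' : Phase [⋀^Fin p]→L[ℝ] ℂ)
    (b : Phase [⋀^Fin q]→L[ℝ] ℂ) : wedge h (a + a') b = wedge h a b + wedge h a' b := by
  ext v
  simp only [wedge_apply, ContinuousAlternatingMap.add_apply, add_mul, smul_add,
    Finset.sum_add_distrib]

theorem wedge_zero_left {p q n : ℕ} (h : p + q = n) (b : Phase [⋀^Fin q]→L[ℝ] ℂ) :
    wedge h 0 b = 0 := by
  ext v
  simp [wedge_apply]

theorem wedge_zero_right {p q n : ℕ} (h : p + q = n) (a : Phase [⋀^Fin p]→L[ℝ] ℂ) :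
    wedge h a 0 = 0 := by
  ext v
  simp [wedge_apply]

theorem covector_smul_zero {n : ℕ} (c : ℂ) : c • (0 : Phase [⋀^Fin n]→L[ℝ] ℂ) = 0 := by
  ext v
  exact mul_zero c

theorem mwedge_add_left (a a' b : MixedForm) : mwedge (a + a') b = mwedge a b + mwedge a' b := by
  funext n
  simp only [mwedge, Pi.add_apply, wedge_add_left, Finset.sum_add_distrib]

theorem ofDegree_same (n : ℕ) (a : Phase [⋀^Fin n]→L[ℝ] ℂ) : ofDegree n a n = a := by
  simp [ofDegree]

theorem ofDegree_of_ne {m n : ℕ} (h : m ≠ n) (a : Phase [⋀^Fin n]→L[ℝ] ℂ) :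
    ofDegree n a m = 0 := by
  simp [ofDegree, h]

theorem ofDegree_smul (n : ℕ) (c : ℂ) (a : Phase [⋀^Fin n]→L[ℝ] ℂ) :
    ofDegree n (c • a) = c • ofDegree n a := by
  funext m
  by_cases h : m = n
  · subst h; simp only [Pi.smul_apply, ofDegree_same]
  · simp only [Pi.smul_apply, ofDegree_of_ne h, covector_smul_zero]

theorem mwedge_ofDegree {p q n : ℕ} (h : p + q = n) (a : Phase [⋀^Fin p]→L[ℝ] ℂ)
    (b : MixedForm) : mwedge (ofDegree p a) b n = wedge h a (b q) := by
  rw [mwedge, Finset.sum_eq_single ⟨(p, q), Finset.HasAntidiagonal.mem_antidiagonal.2 h⟩]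
  · simp only [ofDegree_same]
  · rintro ⟨⟨p', q'⟩, h'⟩ - hne
    have h2 : p' ≠ p := by
      rintro rfl
      refine hne ?_
      have := Finset.HasAntidiagonal.mem_antidiagonal.1 h'
      have hq : q' = q := by simp only at this; omega
      subst hq
      rfl
    simp only [ofDegree_of_ne h2, wedge_zero_left]
  · intro h'
    exact absurd (Finset.mem_attach _ _) h'

theorem mwedge_ofDegree_of_lt {p n : ℕ} (h : n < p) (a : Phase [⋀^Fin p]→L[ℝ] ℂ)
    (b : MixedForm) : mwedge (ofDegree p a) b n = 0 := by
  rw [mwedge]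
  refine Finset.sum_eq_zero ?_
  rintro ⟨⟨p', q'⟩, h'⟩ -
  have h2 : p' ≠ p := by
    have := Finset.HasAntidiagonal.mem_antidiagonal.1 h'
    simp only at this; omega
  simp only [ofDegree_of_ne h2, wedge_zero_left]

/-- A real covector with complex coefficients. -/
def complexify {n : ℕ} (a : Phase [⋀^Fin n]→L[ℝ] ℝ) : Phase [⋀^Fin n]→L[ℝ] ℂ :=
  Complex.ofRealCLM.compContinuousAlternatingMap a

theorem complexify_apply {n : ℕ} (a : Phase [⋀^Fin n]→L[ℝ] ℝ) (v : Fin n → Phase) :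
    complexify a v = (a v : ℂ) := rfl

/-- The `2`-covector `σ + c Ω`. -/
def twistForm (σ : Phase [⋀^Fin 2]→L[ℝ] ℝ) (c : ℂ) : Phase [⋀^Fin 2]→L[ℝ] ℂ :=
  complexify σ + c • complexify Omega

theorem twistForm_apply (σ : Phase [⋀^Fin 2]→L[ℝ] ℝ) (c : ℂ) (v : Fin 2 → Phase) :
    twistForm σ c v = σ v + c * Omega v := rfl

theorem Theta_eq (σ : Phase [⋀^Fin 2]→L[ℝ] ℝ) : Theta σ = ofDegree 2 (twistForm σ (-Complex.I)) := by
  have h : ∀ a : Phase [⋀^Fin 2]→L[ℝ] ℂ, ofDegree 2 (-Complex.I • a) =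
      -(Complex.I • ofDegree 2 a) := fun a => by
    rw [ofDegree_smul]
    funext m; ext v
    exact neg_mul _ _
  rw [Theta, sub_eq_add_neg, twistForm, ofDegree, Pi.single_add]
  exact congrArg _ (h _).symm

theorem Phi_zero (σ : Phase [⋀^Fin 2]→L[ℝ] ℝ) :
    Phi σ 0 = ContinuousAlternatingMap.constOfIsEmpty ℝ Phase (Fin 0) 1 := by
  simp [Phi, Theta_eq, scalar, ofDegree_same, ofDegree_of_ne, mwedge_ofDegree_of_lt,
    covector_smul_zero]

theorem Phi_two (σ : Phase [⋀^Fin 2]→L[ℝ] ℝ) : Phi σ 2 = twistForm σ (-Complex.I) := by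
  have h : mwedge (ofDegree 2 (twistForm σ (-Complex.I))) (ofDegree 2 (twistForm σ (-Complex.I))) 2
      = 0 := by
    rw [mwedge_ofDegree (q := 0) rfl, ofDegree_of_ne (by decide), wedge_zero_right]
  simp [Phi, Theta_eq, scalar, ofDegree_same, ofDegree_of_ne, h, covector_smul_zero]

theorem Phi_four (σ : Phase [⋀^Fin 2]→L[ℝ] ℝ) (X Y Z W : Phase) :
    Phi σ 4 ![X, Y, Z, W] =
      twistForm σ (-Complex.I) ![X, Y] * twistForm σ (-Complex.I) ![Z, W] -
      twistForm σ (-Complex.I) ![X, Z] * twistForm σ (-Complex.I) ![Y, W] +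
      twistForm σ (-Complex.I) ![X, W] * twistForm σ (-Complex.I) ![Y, Z] := by
  have h := wedge_two_two (twistForm σ (-Complex.I)) (twistForm σ (-Complex.I)) X Y Z W
  simp only [Phi, Theta_eq, scalar, Pi.add_apply, Pi.smul_apply, mwedge_ofDegree (q := 2) rfl,
    ofDegree_same, ContinuousAlternatingMap.add_apply, ContinuousAlternatingMap.smul_apply, h,
    ofDegree_of_ne (show 4 ≠ 0 by decide), ofDegree_of_ne (show 4 ≠ 2 by decide),
    ContinuousAlternatingMap.coe_zero, Pi.zero_apply, smul_eq_mul]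
  ring

theorem Phi_odd (σ : Phase [⋀^Fin 2]→L[ℝ] ℝ) (k : ℕ) : Phi σ (2 * k + 1) = 0 := by
  by_cases hk : 2 ≤ k
  · exact alternating_eq_zero (by omega) _
  have h : mwedge (ofDegree 2 (twistForm σ (-Complex.I))) (ofDegree 2 (twistForm σ (-Complex.I)))
      (2 * k + 1) = 0 := by
    interval_cases k
    · exact mwedge_ofDegree_of_lt (by decide) _ _
    · rw [mwedge_ofDegree (q := 1) rfl, ofDegree_of_ne (by decide), wedge_zero_right]
  simp [Phi, Theta_eq, scalar, ofDegree_of_ne, h, covector_smul_zero]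

end MixedForms

open TensorProduct

/-! ### Description of Ē as a graph over the complexified tangent space. -/

section Eigenbundle

/-- The element `X - ι_X (σ + i Ω)` of `Ē`. -/
def eBar (σ : Phase [⋀^Fin 2]→L[ℝ] ℝ) (X : Phase) : TensorProduct ℝ ℂ GenTangent :=
  (1 : ℂ) ⊗ₜ[ℝ] ((X, -flat σ X) : GenTangent) + Complex.I ⊗ₜ[ℝ] ((0, -flat Omega X) : GenTangent)

theorem exists_tmul_add_I_tmul (e : TensorProduct ℝ ℂ GenTangent) :
    ∃ u v : GenTangent, e = (1 : ℂ) ⊗ₜ[ℝ] u + Complex.I ⊗ₜ[ℝ] v := by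
  induction e using TensorProduct.induction_on with
  | zero => exact ⟨0, 0, by simp⟩
  | tmul c u =>
    refine ⟨c.re • u, c.im • u, ?_⟩
    rw [← TensorProduct.smul_tmul, ← TensorProduct.smul_tmul, ← TensorProduct.add_tmul]
    congr 1
    apply Complex.ext <;> simp
  | add e e' h h' =>
    obtain ⟨u, v, rfl⟩ := h
    obtain ⟨u', v', rfl⟩ := h'
    refine ⟨u + u', v + v', ?_⟩
    rw [TensorProduct.tmul_add, TensorProduct.tmul_add]
    abel

theorem eq_zero_of_tmul_add_I_tmul {u v : GenTangent}
    (h : (1 : ℂ) ⊗ₜ[ℝ] u + Complex.I ⊗ₜ[ℝ] v = 0) : u = 0 ∧ v = 0 := by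
  have key : ∀ l : ℂ →ₗ[ℝ] ℝ, l 1 • u + l Complex.I • v = 0 := fun l => by
    have := congrArg (TensorProduct.lid ℝ GenTangent ∘ l.rTensor GenTangent) h
    simpa only [Function.comp_apply, map_add, LinearMap.rTensor_tmul, TensorProduct.lid_tmul,
      map_zero] using this
  have h1 := key Complex.reLm
  have h2 := key Complex.imLm
  simp at h1 h2
  exact ⟨h1, h2⟩

/-- Separates the eigenvector equation (𝕁 + i)(u + iv) = 0 into real and imaginary parts. -/
theorem genJ_tmul (σ : Phase [⋀^Fin 2]→L[ℝ] ℝ) (u v : GenTangent) :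
    ((genJ σ).baseChange ℂ + Complex.I • LinearMap.id :
        TensorProduct ℝ ℂ GenTangent →ₗ[ℂ] TensorProduct ℝ ℂ GenTangent)
      ((1 : ℂ) ⊗ₜ[ℝ] u + Complex.I ⊗ₜ[ℝ] v) =
    (1 : ℂ) ⊗ₜ[ℝ] (genJ σ u - v) + Complex.I ⊗ₜ[ℝ] (genJ σ v + u) := by
  have h : Complex.I • Complex.I ⊗ₜ[ℝ] v = (1 : ℂ) ⊗ₜ[ℝ] (-v) := by
    rw [TensorProduct.smul_tmul', smul_eq_mul, Complex.I_mul_I, TensorProduct.neg_tmul,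
      TensorProduct.tmul_neg]
  rw [LinearMap.add_apply, map_add, LinearMap.smul_apply, LinearMap.id_apply, smul_add, h,
    LinearMap.baseChange_tmul, LinearMap.baseChange_tmul, TensorProduct.smul_tmul', smul_eq_mul,
    mul_one, sub_eq_add_neg, TensorProduct.tmul_add, TensorProduct.tmul_add]
  abel

theorem genJ_apply (σ : Phase [⋀^Fin 2]→L[ℝ] ℝ) (X : Phase) (ξ : Covec) :
    genJ σ (X, ξ) = (tensorA σ X + sharp ξ,
      -flat Omega (X + tensorA σ (tensorA σ X))
        - ξ.comp (LinearMap.toContinuousLinearMap (tensorA σ))) := rfl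

theorem flat_Omega_tensorA (σ : Phase [⋀^Fin 2]→L[ℝ] ℝ) (X : Phase) :
    flat Omega (tensorA σ X) = flat σ X := by
  rw [tensorA, LinearMap.comp_apply, flat_sharp]

theorem flat_swap (σ : Phase [⋀^Fin 2]→L[ℝ] ℝ) (X Y : Phase) : flat σ X Y = -flat σ Y X := by
  rw [flat_apply, flat_apply, alternating_two_swap]

theorem flat_comp_tensorA (σ : Phase [⋀^Fin 2]→L[ℝ] ℝ) (X : Phase) :
    (flat Omega X).comp (LinearMap.toContinuousLinearMap (tensorA σ)) = flat σ X := by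
  ext Y
  change flat Omega X (tensorA σ Y) = _
  rw [flat_swap, flat_Omega_tensorA, ← flat_swap]

theorem flat_comp_tensorA' (σ : Phase [⋀^Fin 2]→L[ℝ] ℝ) (X : Phase) :
    (flat σ X).comp (LinearMap.toContinuousLinearMap (tensorA σ)) = flat σ (tensorA σ X) := by
  rw [← flat_Omega_tensorA, flat_comp_tensorA]

/-- 𝕁 sends X - ι_X σ to -ι_X Ω, and -ι_X Ω to minus X - ι_X σ; these are the real and imaginary
parts of the element. -/
theorem eBar_mem (σ : Phase [⋀^Fin 2]→L[ℝ] ℝ) (X : Phase) : eBar σ X ∈ eigenBar σ := by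
  have h1 : sharp (flat σ X) = tensorA σ X := rfl
  have h2 : (-flat σ X).comp (LinearMap.toContinuousLinearMap (tensorA σ)) =
      -flat σ (tensorA σ X) := by
    rw [← flat_comp_tensorA', ContinuousLinearMap.neg_comp]
  have h3 : (-flat Omega X).comp (LinearMap.toContinuousLinearMap (tensorA σ)) =
      -flat σ X := by
    rw [← flat_comp_tensorA σ X, ContinuousLinearMap.neg_comp]
  have e1 : genJ σ (X, -flat σ X) - (0, -flat Omega X) = 0 := by
    rw [genJ_apply, h2, map_neg, h1, map_add, flat_Omega_tensorA]
    ext <;> simp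
  have e2 : genJ σ (0, -flat Omega X) + (X, -flat σ X) = 0 := by
    rw [genJ_apply, h3, map_neg, sharp_flat]
    ext <;> simp
  rw [eigenBar, LinearMap.mem_ker, eBar, genJ_tmul, e1, e2]
  simp

/-- The tangent components of the eigenvector equation already determine the cotangent parts,
because Ω⁻¹ is invertible. So an element of Ē is fixed by its complex tangent vector X + iY. -/
theorem exists_eBar_of_mem (σ : Phase [⋀^Fin 2]→L[ℝ] ℝ) {e : TensorProduct ℝ ℂ GenTangent}
    (he : e ∈ eigenBar σ) : ∃ X Y : Phase, e = eBar σ X + Complex.I • eBar σ Y := by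
  obtain ⟨⟨X, ξ⟩, ⟨Y, η⟩, rfl⟩ := exists_tmul_add_I_tmul e
  rw [eigenBar, LinearMap.mem_ker, genJ_tmul] at he
  obtain ⟨h1, h2⟩ := eq_zero_of_tmul_add_I_tmul he
  rw [genJ_apply] at h1 h2
  have h1' : tensorA σ X + sharp ξ - Y = 0 := congrArg Prod.fst h1
  have h2' : tensorA σ Y + sharp η + X = 0 := congrArg Prod.fst h2
  refine ⟨X, Y, ?_⟩
  have hξ : ξ = flat Omega Y - flat σ X := by
    have := congrArg (flat Omega) h1'
    rw [map_sub, map_add, flat_sharp, flat_Omega_tensorA, map_zero, sub_eq_zero] at this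
    rw [← this]; abel
  have hη : η = -flat Omega X - flat σ Y := by
    have := congrArg (flat Omega) h2'
    rw [map_add, map_add, flat_sharp, flat_Omega_tensorA, map_zero, add_eq_zero_iff_eq_neg] at this
    rw [← this]; abel
  have hI : ∀ v : GenTangent, Complex.I • Complex.I ⊗ₜ[ℝ] v = (1 : ℂ) ⊗ₜ[ℝ] (-v) := fun v => by
    rw [TensorProduct.smul_tmul', smul_eq_mul, Complex.I_mul_I, TensorProduct.neg_tmul,
      TensorProduct.tmul_neg]
  rw [eBar, eBar, smul_add, hI, TensorProduct.smul_tmul', smul_eq_mul, mul_one]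
  have e1 : ((X, ξ) : GenTangent) = (X, -flat σ X) + -(0, -flat Omega Y) := by
    ext i
    · simp
    · simp [hξ]; ring
  have e2 : ((Y, η) : GenTangent) = (Y, -flat σ Y) + (0, -flat Omega X) := by
    ext i
    · simp
    · simp [hη]; ring
  rw [e1, e2, TensorProduct.tmul_add, TensorProduct.tmul_add]
  abel

end Eigenbundle

/-! ### The action of Ē, evaluated on vectors. -/

section SpinAction

theorem spin_tmul (c : ℂ) (u : GenTangent) (θ : MixedForm) :
    spin (c ⊗ₜ[ℝ] u) θ = c • spinFun u θ := by
  simp [spin]; rfl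

theorem spin_eBar (σ : Phase [⋀^Fin 2]→L[ℝ] ℝ) (X : Phase) (θ : MixedForm) :
    spin (eBar σ X) θ = spinFun (X, -flat σ X) θ + Complex.I • spinFun (0, -flat Omega X) θ := by
  rw [eBar, map_add, LinearMap.add_apply, spin_tmul, spin_tmul, one_smul]

/-- `β = σ + i Ω`. -/
def barForm (σ : Phase [⋀^Fin 2]→L[ℝ] ℝ) : Phase [⋀^Fin 2]→L[ℝ] ℂ := twistForm σ Complex.I

theorem spin_eBar_apply_zero (σ : Phase [⋀^Fin 2]→L[ℝ] ℝ) (X : Phase) (θ : MixedForm) (v) :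
    spin (eBar σ X) θ 0 v = θ 1 ![X] := by
  rw [spin_eBar]
  change θ 1 (Matrix.vecCons X v) + Complex.I * θ 1 (Matrix.vecCons 0 v) = _
  rw [(θ 1).map_coord_zero (m := Matrix.vecCons 0 v) 0 rfl, mul_zero, add_zero]
  congr 1
  ext i : 1; fin_cases i; rfl

/-- This is ι_X θ - ι_X β ∧ θ with β = σ + iΩ, that is e^β ι_X (e^{-β} θ). -/
theorem spin_eBar_apply_succ (σ : Phase [⋀^Fin 2]→L[ℝ] ℝ) (X : Phase) (θ : MixedForm) (m : ℕ)
    (v : Fin (m + 1) → Phase) :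
    spin (eBar σ X) θ (m + 1) v = θ (m + 2) (Matrix.vecCons X v) -
      ∑ i : Fin (m + 1), (-1) ^ (i : ℕ) * (barForm σ ![X, v i] * θ m (Fin.removeNth i v)) := by
  have h : ∀ (Y : Phase) (ξ : Covec), spinFun (Y, ξ) θ (m + 1) v =
      θ (m + 2) (Matrix.vecCons Y v) +
      ∑ i : Fin (m + 1), (-1) ^ (i : ℕ) * (ξ (v i) * θ m (Fin.removeNth i v)) := fun Y ξ => by
    simp [spinFun, ContinuousAlternatingMap.alternatizeUncurryFin_apply]
  rw [spin_eBar]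
  change spinFun (X, -flat σ X) θ (m + 1) v + Complex.I * spinFun (0, -flat Omega X) θ (m + 1) v = _
  rw [h, h, (θ (m + 2)).map_coord_zero (m := Matrix.vecCons 0 v) 0 rfl, zero_add, add_assoc,
    sub_eq_add_neg, Finset.mul_sum, ← Finset.sum_add_distrib, ← Finset.sum_neg_distrib]
  congr 1
  refine Finset.sum_congr rfl fun i _ => ?_
  simp only [barForm, twistForm_apply, neg_apply, flat_apply,
    Complex.ofReal_neg]
  ring

theorem spin_eBar_apply_one (σ : Phase [⋀^Fin 2]→L[ℝ] ℝ) (X : Phase) (θ : MixedForm)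
    (Y : Phase) :
    spin (eBar σ X) θ 1 ![Y] = θ 2 ![X, Y] - barForm σ ![X, Y] * θ 0 ![] := by
  rw [spin_eBar_apply_succ]
  simp

theorem spin_eBar_apply_two (σ : Phase [⋀^Fin 2]→L[ℝ] ℝ) (X : Phase) (θ : MixedForm)
    (Y Z : Phase) :
    spin (eBar σ X) θ 2 ![Y, Z] = θ 3 ![X, Y, Z] - barForm σ ![X, Y] * θ 1 ![Z] +
      barForm σ ![X, Z] * θ 1 ![Y] := by
  have h1 : Fin.removeNth (1 : Fin 2) ![Y, Z] = ![Y] := by ext i : 1; fin_cases i; rfl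
  rw [spin_eBar_apply_succ]
  simp [Fin.sum_univ_succ, h1]
  ring

theorem spin_eBar_apply_three (σ : Phase [⋀^Fin 2]→L[ℝ] ℝ) (X : Phase) (θ : MixedForm)
    (Y Z W : Phase) :
    spin (eBar σ X) θ 3 ![Y, Z, W] = θ 4 ![X, Y, Z, W] - barForm σ ![X, Y] * θ 2 ![Z, W] +
      barForm σ ![X, Z] * θ 2 ![Y, W] - barForm σ ![X, W] * θ 2 ![Y, Z] := by
  have h1 : Fin.removeNth (1 : Fin 3) ![Y, Z, W] = ![Y, W] := by ext i : 1; fin_cases i <;> rfl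
  have h2 : Fin.removeNth (2 : Fin 3) ![Y, Z, W] = ![Y, Z] := by ext i : 1; fin_cases i <;> rfl
  rw [spin_eBar_apply_succ]
  simp [Fin.sum_univ_succ, h1, h2]
  ring

theorem spin_eBar_apply_four (σ : Phase [⋀^Fin 2]→L[ℝ] ℝ) (X : Phase) (θ : MixedForm)
    (Y Z W V : Phase) :
    spin (eBar σ X) θ 4 ![Y, Z, W, V] = -(barForm σ ![X, Y] * θ 3 ![Z, W, V]) +
      barForm σ ![X, Z] * θ 3 ![Y, W, V] - barForm σ ![X, W] * θ 3 ![Y, Z, V] +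
      barForm σ ![X, V] * θ 3 ![Y, Z, W] := by
  have h1 : Fin.removeNth (1 : Fin 4) ![Y, Z, W, V] = ![Y, W, V] := by
    ext i : 1; fin_cases i <;> rfl
  have h2 : Fin.removeNth (2 : Fin 4) ![Y, Z, W, V] = ![Y, Z, V] := by
    ext i : 1; fin_cases i <;> rfl
  have h3 : Fin.removeNth (3 : Fin 4) ![Y, Z, W, V] = ![Y, Z, W] := by
    ext i : 1; fin_cases i <;> rfl
  -- The contraction of the part of degree 5 drops out in dimension 4.
  rw [spin_eBar_apply_succ, alternating_eq_zero (n := 3 + 2) le_rfl (θ (3 + 2))]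
  simp [Fin.sum_univ_succ, h1, h2, h3]
  ring

end SpinAction

/-! ### Upper bounds for the spaces U_k. -/

section Chain

/-- The forms of even degree. -/
def evenSpace : Submodule ℂ MixedForm where
  carrier := {θ | ∀ k, θ (2 * k + 1) = 0}
  add_mem' h h' k := by rw [Pi.add_apply, h k, h' k, add_zero]
  zero_mem' _ := rfl
  smul_mem' c θ h k := by rw [Pi.smul_apply, h k, covector_smul_zero]

/-- The forms `ξ ∧ exp β` of odd degree, with `ξ` of degree `1`. -/
def oddExpSpace (β : Phase [⋀^Fin 2]→L[ℝ] ℂ) : Submodule ℂ MixedForm where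
  carrier := {θ | (∀ k, θ (2 * k) = 0) ∧ ∀ X Y Z, θ 3 ![X, Y, Z] =
    θ 1 ![X] * β ![Y, Z] - θ 1 ![Y] * β ![X, Z] + θ 1 ![Z] * β ![X, Y]}
  add_mem' {θ η} h h' := by
    refine ⟨fun k => by rw [Pi.add_apply, h.1 k, h'.1 k, add_zero], fun X Y Z => ?_⟩
    simp only [Pi.add_apply, ContinuousAlternatingMap.add_apply, h.2, h'.2]
    ring
  zero_mem' := ⟨fun _ => rfl, fun _ _ _ => by simp⟩
  smul_mem' c θ h := by
    refine ⟨fun k => by rw [Pi.smul_apply, h.1 k, covector_smul_zero], fun X Y Z => ?_⟩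
    simp only [Pi.smul_apply, ContinuousAlternatingMap.smul_apply, h.2, smul_eq_mul]
    ring

/-- The forms of even degree `exp β ∧ (c + η)`, with `c` of degree `0` and `η` of degree `2`. -/
def evenExpSpace (β : Phase [⋀^Fin 2]→L[ℝ] ℂ) : Submodule ℂ MixedForm where
  carrier := {θ | (∀ k, θ (2 * k + 1) = 0) ∧ ∀ X Y Z W, θ 4 ![X, Y, Z, W] =
    β ![X, Y] * θ 2 ![Z, W] - β ![X, Z] * θ 2 ![Y, W] + β ![X, W] * θ 2 ![Y, Z] +
    β ![Y, Z] * θ 2 ![X, W] - β ![Y, W] * θ 2 ![X, Z] + β ![Z, W] * θ 2 ![X, Y] -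
    θ 0 ![] * (β ![X, Y] * β ![Z, W] - β ![X, Z] * β ![Y, W] + β ![X, W] * β ![Y, Z])}
  add_mem' {θ η} h h' := by
    refine ⟨fun k => by rw [Pi.add_apply, h.1 k, h'.1 k, add_zero], fun X Y Z W => ?_⟩
    simp only [Pi.add_apply, ContinuousAlternatingMap.add_apply, h.2, h'.2]
    ring
  zero_mem' := ⟨fun _ => rfl, fun _ _ _ _ => by simp⟩
  smul_mem' c θ h := by
    refine ⟨fun k => by rw [Pi.smul_apply, h.1 k, covector_smul_zero], fun X Y Z W => ?_⟩
    simp only [Pi.smul_apply, ContinuousAlternatingMap.smul_apply, h.2, smul_eq_mul]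
    ring

theorem eq_of_mem_oddExpSpace {β : Phase [⋀^Fin 2]→L[ℝ] ℂ} {θ η : MixedForm}
    (hθ : θ ∈ oddExpSpace β) (hη : η ∈ oddExpSpace β) (h : ∀ X, θ 1 ![X] = η 1 ![X]) :
    θ = η := by
  funext n
  rcases Nat.even_or_odd' n with ⟨k, rfl | rfl⟩
  · rw [hθ.1, hη.1]
  rcases k with _ | _ | k
  · ext v
    rw [vec_one_eta v]
    exact h _
  · ext v
    change θ 3 v = η 3 v
    rw [vec_three_eta v, hθ.2, hη.2, h, h, h]
  · rw [alternating_eq_zero (by omega) (θ _), alternating_eq_zero (by omega) (η _)]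

theorem covector_zero_ext {a b : Phase [⋀^Fin 0]→L[ℝ] ℂ} (h : a ![] = b ![])
    (v : Fin 0 → Phase) : a v = b v := by
  rw [Subsingleton.elim v ![], h]

theorem eq_of_mem_evenExpSpace {β : Phase [⋀^Fin 2]→L[ℝ] ℂ} {θ η : MixedForm}
    (hθ : θ ∈ evenExpSpace β) (hη : η ∈ evenExpSpace β) (h0 : θ 0 ![] = η 0 ![])
    (h2 : ∀ X Y, θ 2 ![X, Y] = η 2 ![X, Y]) : θ = η := by
  funext n
  rcases Nat.even_or_odd' n with ⟨k, rfl | rfl⟩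
  · rcases k with _ | _ | _ | k
    · ext v
      exact covector_zero_ext h0 v
    · ext v
      change θ 2 v = η 2 v
      rw [vec_two_eta v, h2]
    · ext v
      change θ 4 v = η 4 v
      rw [vec_four_eta v, hθ.2, hη.2]
      simp only [h0, h2]
    · rw [alternating_eq_zero (by omega) (θ _), alternating_eq_zero (by omega) (η _)]
  · rw [hθ.1, hη.1]

variable (σ : Phase [⋀^Fin 2]→L[ℝ] ℝ)

theorem spin_eBar_odd {θ : MixedForm} (h : ∀ k, θ (2 * k + 1) = 0) (X : Phase) (k : ℕ) :
    spin (eBar σ X) θ (2 * k) = 0 := by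
  ext v
  cases k with
  | zero =>
    change spin (eBar σ X) θ 0 v = 0
    rw [spin_eBar_apply_zero, show θ 1 = 0 from h 0]
    rfl
  | succ k =>
    change spin (eBar σ X) θ (2 * k + 1 + 1) v = 0
    rw [spin_eBar_apply_succ, h k, show θ (2 * k + 1 + 2) = 0 from h (k + 1)]
    simp

theorem spin_eBar_even {θ : MixedForm} (h : ∀ k, θ (2 * k) = 0) (X : Phase) (k : ℕ) :
    spin (eBar σ X) θ (2 * k + 1) = 0 := by
  ext v
  rw [spin_eBar_apply_succ, h k, show θ (2 * k + 2) = 0 from h (k + 1)]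
  simp

/-- In dimension `4` the exterior product of a `2`-covector and a `3`-covector vanishes. -/
theorem two_wedge_three_eq_zero (β : Phase [⋀^Fin 2]→L[ℝ] ℂ) (τ : Phase [⋀^Fin 3]→L[ℝ] ℂ)
    (A B C D E : Phase) :
    β ![A, B] * τ ![C, D, E] - β ![A, C] * τ ![B, D, E] + β ![A, D] * τ ![B, C, E]
      - β ![A, E] * τ ![B, C, D] + β ![B, C] * τ ![A, D, E] - β ![B, D] * τ ![A, C, E]
      + β ![B, E] * τ ![A, C, D] + β ![C, D] * τ ![A, B, E] - β ![C, E] * τ ![A, B, D]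
      + β ![D, E] * τ ![A, B, C] = 0 := by
  let b : Phase → Phase →L[ℝ] ℂ := fun X =>
    (ContinuousAlternatingMap.ofSubsingleton ℝ Phase ℂ (0 : Fin 1)).symm (β.curryLeft X)
  have hb : ∀ X Y, b X Y = β ![X, Y] := fun X Y => by
    change β _ = _
    congr 1
    ext i : 1; fin_cases i <;> rfl
  -- S X is ι_X β ∧ τ. Its antisymmetrisation in X is a 5-covector, hence zero, and it contains each
  -- of the ten terms twice, through β(A, B) and -β(B, A); whence the final factor 1/2.
  let S : Phase → Phase [⋀^Fin 4]→L[ℝ] ℂ := fun X =>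
    ContinuousAlternatingMap.alternatizeUncurryFin ((b X).smulRight τ)
  have hS : ∀ X Y Z W V, S X ![Y, Z, W, V] = β ![X, Y] * τ ![Z, W, V] - β ![X, Z] * τ ![Y, W, V] +
      β ![X, W] * τ ![Y, Z, V] - β ![X, V] * τ ![Y, Z, W] := fun X Y Z W V => by
    have h1 : Fin.removeNth (1 : Fin 4) ![Y, Z, W, V] = ![Y, W, V] := by
      ext i : 1; fin_cases i <;> rfl
    have h2 : Fin.removeNth (2 : Fin 4) ![Y, Z, W, V] = ![Y, Z, V] := by
      ext i : 1; fin_cases i <;> rfl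
    have h3 : Fin.removeNth (3 : Fin 4) ![Y, Z, W, V] = ![Y, Z, W] := by
      ext i : 1; fin_cases i <;> rfl
    simp only [S, ContinuousAlternatingMap.alternatizeUncurryFin_apply]
    simp [Fin.sum_univ_succ, h1, h2, h3, hb]
    ring
  let T : Phase →ₗ[ℝ] Phase [⋀^Fin 4]→L[ℝ] ℂ :=
    { toFun := S
      map_add' := fun X Y => by
        ext v
        rw [vec_four_eta v, ContinuousAlternatingMap.add_apply]
        simp only [hS, ← hb]
        simp [b]
        ring
      map_smul' := fun c X => by
        ext v
        rw [vec_four_eta v, ContinuousAlternatingMap.smul_apply]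
        simp only [hS, ← hb]
        simp [b]
        ring }
  have h0 := congrArg (fun a => a ![A, B, C, D, E]) (alternating_eq_zero (n := 4 + 1) le_rfl
    (ContinuousAlternatingMap.alternatizeUncurryFin (LinearMap.toContinuousLinearMap T)))
  have h1 : Fin.removeNth (1 : Fin 5) ![A, B, C, D, E] = ![A, C, D, E] := by
    ext i : 1; fin_cases i <;> rfl
  have h2 : Fin.removeNth (2 : Fin 5) ![A, B, C, D, E] = ![A, B, D, E] := by
    ext i : 1; fin_cases i <;> rfl
  have h3 : Fin.removeNth (3 : Fin 5) ![A, B, C, D, E] = ![A, B, C, E] := by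
    ext i : 1; fin_cases i <;> rfl
  have h4 : Fin.removeNth (4 : Fin 5) ![A, B, C, D, E] = ![A, B, C, D] := by
    ext i : 1; fin_cases i <;> rfl
  simp [ContinuousAlternatingMap.alternatizeUncurryFin_apply, Fin.sum_univ_succ, h1, h2, h3, h4,
    T, hS] at h0
  rw [alternating_two_swap β B A, alternating_two_swap β C A, alternating_two_swap β D A,
    alternating_two_swap β E A, alternating_two_swap β C B, alternating_two_swap β D B,
    alternating_two_swap β E B, alternating_two_swap β D C, alternating_two_swap β E C,
    alternating_two_swap β E D] at h0
  linear_combination (1 / 2 : ℂ) * h0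

theorem twistForm_sub (X Y : Phase) :
    twistForm σ (-Complex.I) ![X, Y] = barForm σ ![X, Y] - 2 * Complex.I * Omega ![X, Y] := by
  rw [barForm, twistForm_apply, twistForm_apply]
  ring

theorem spin_eBar_Phi_one (X Y : Phase) :
    spin (eBar σ X) (Phi σ) 1 ![Y] = -(2 * Complex.I * Omega ![X, Y]) := by
  rw [spin_eBar_apply_one, Phi_two, Phi_zero, ContinuousAlternatingMap.constOfIsEmpty_apply,
    twistForm_sub]
  ring

/-- Since ι_X Φ = ι_X (σ - iΩ) ∧ Φ, the two contractions combine into -2i ι_X Ω ∧ Φ. -/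
theorem spin_eBar_Phi_mem (X : Phase) :
    spin (eBar σ X) (Phi σ) ∈ oddExpSpace (twistForm σ (-Complex.I)) := by
  refine ⟨spin_eBar_odd σ (Phi_odd σ) X, fun Y Z W => ?_⟩
  rw [spin_eBar_apply_three, spin_eBar_Phi_one, spin_eBar_Phi_one, spin_eBar_Phi_one, Phi_four,
    Phi_two, twistForm_sub σ X Y, twistForm_sub σ X Z, twistForm_sub σ X W]
  ring

/-- For odd θ, the form e^{-β} θ has degrees 1 and 3, so its contraction has degrees 0 and 2 only:
no part of degree 4 remains after untwisting. -/
theorem spin_eBar_mem_evenExpSpace {θ : MixedForm} (h : ∀ k, θ (2 * k) = 0) (X : Phase) :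
    spin (eBar σ X) θ ∈ evenExpSpace (barForm σ) := by
  refine ⟨spin_eBar_even σ h X, fun Y Z W V => ?_⟩
  simp only [spin_eBar_apply_four, spin_eBar_apply_two, spin_eBar_apply_zero]
  -- Two 5-covectors vanish: θ₁ ∧ β ∧ β here, and β ∧ θ₃ in the last line.
  have h := two_wedge_three_eq_zero (barForm σ) (wedge rfl (θ 1) (barForm σ)) X Y Z W V
  simp only [wedge_one_two] at h
  linear_combination (1 / 2 : ℂ) * h - two_wedge_three_eq_zero (barForm σ) (θ 3) X Y Z W V

/-- After untwisting, contraction takes degrees 0 and 2 to degree 1 alone. -/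
theorem spin_eBar_mem_oddExpSpace {θ : MixedForm} (h : θ ∈ evenExpSpace (barForm σ)) (X : Phase) :
    spin (eBar σ X) θ ∈ oddExpSpace (barForm σ) := by
  refine ⟨spin_eBar_odd σ h.1 X, fun Y Z W => ?_⟩
  simp only [spin_eBar_apply_three, spin_eBar_apply_one, h.2]
  ring

/-- Upper bounds for the images of the powers of `Ē` acting on `Φ`. -/
def spinChain : ℕ → Submodule ℂ MixedForm
  | 0 => ℂ ∙ Phi σ
  | 1 => oddExpSpace (twistForm σ (-Complex.I))
  | 2 => evenExpSpace (barForm σ)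
  | 3 => oddExpSpace (barForm σ)
  | 4 => evenSpace
  | _ => ⊤

theorem spin_eBar_mem_spinChain (n : ℕ) {θ : MixedForm} (h : θ ∈ spinChain σ n) (X : Phase) :
    spin (eBar σ X) θ ∈ spinChain σ (n + 1) := by
  rcases n with _ | _ | _ | _ | n
  · obtain ⟨c, rfl⟩ := Submodule.mem_span_singleton.1 h
    rw [map_smul]
    exact Submodule.smul_mem _ _ (spin_eBar_Phi_mem σ X)
  · exact spin_eBar_mem_evenExpSpace σ h.1 X
  · exact spin_eBar_mem_oddExpSpace σ h X
  · exact spin_eBar_even σ h.1 X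
  · trivial

theorem spin_mem_spinChain (n : ℕ) {θ : MixedForm} (h : θ ∈ spinChain σ n)
    {e : TensorProduct ℝ ℂ GenTangent} (he : e ∈ eigenBar σ) :
    spin e θ ∈ spinChain σ (n + 1) := by
  obtain ⟨X, Y, rfl⟩ := exists_eBar_of_mem σ he
  rw [map_add, map_smul]
  exact Submodule.add_mem _ (spin_eBar_mem_spinChain σ n h X)
    (Submodule.smul_mem _ _ (spin_eBar_mem_spinChain σ n h Y))

theorem foldr_spin_mem_spinChain (l : List (TensorProduct ℝ ℂ GenTangent))
    (hl : ∀ e ∈ l, e ∈ eigenBar σ) :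
    l.foldr (fun e η => spin e η) (Phi σ) ∈ spinChain σ l.length := by
  induction l with
  | nil => exact Submodule.mem_span_singleton_self _
  | cons e l ih =>
    exact spin_mem_spinChain σ _ (ih fun e' he' => hl e' (List.mem_cons_of_mem _ he'))
      (hl e List.mem_cons_self)

/-- For U_1 and U_{-1} the reverse inclusions are proved below; for the other spaces only the parity
of the degrees matters in `proj_odd`. -/
theorem gualtieriU_le_spinChain (k : ℤ) (n : ℕ) (h : (n : ℤ) = 2 - k) :
    gualtieriU σ k ≤ spinChain σ n := by
  refine Submodule.span_le.2 ?_
  rintro θ ⟨l, hl, hlen, rfl⟩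
  obtain rfl : l.length = n := by omega
  exact foldr_spin_mem_spinChain σ l hl

theorem spin_mem_gualtieriU_one (X : Phase) : spin (eBar σ X) (Phi σ) ∈ gualtieriU σ 1 :=
  Submodule.subset_span ⟨[eBar σ X], by simp [eBar_mem], by norm_num, rfl⟩

theorem spin_mem_gualtieriU_zero (X Y : Phase) :
    spin (eBar σ X) (spin (eBar σ Y) (Phi σ)) ∈ gualtieriU σ 0 :=
  Submodule.subset_span ⟨[eBar σ X, eBar σ Y], by simp [eBar_mem], by norm_num, rfl⟩

theorem spin_mem_gualtieriU_neg_one (X Y Z : Phase) :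
    spin (eBar σ X) (spin (eBar σ Y) (spin (eBar σ Z) (Phi σ))) ∈ gualtieriU σ (-1) :=
  Submodule.subset_span ⟨[eBar σ X, eBar σ Y, eBar σ Z], by simp [eBar_mem], by norm_num, rfl⟩

theorem spin_spin_Phi_mem (X Y : Phase) :
    spin (eBar σ X) (spin (eBar σ Y) (Phi σ)) ∈ evenExpSpace (barForm σ) :=
  spin_eBar_mem_evenExpSpace σ (spin_eBar_Phi_mem σ Y).1 X

theorem spin_spin_Phi_zero (X Y : Phase) :
    spin (eBar σ X) (spin (eBar σ Y) (Phi σ)) 0 ![] = -(2 * Complex.I * Omega ![Y, X]) := by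
  rw [spin_eBar_apply_zero, spin_eBar_Phi_one]

theorem spin_spin_Phi_two (X Y Z W : Phase) :
    spin (eBar σ X) (spin (eBar σ Y) (Phi σ)) 2 ![Z, W] =
      -(2 * Complex.I * Omega ![Y, X] * twistForm σ (-Complex.I) ![Z, W]) +
      4 * (Omega ![Y, Z] * Omega ![X, W] - Omega ![X, Z] * Omega ![Y, W]) := by
  rw [spin_eBar_apply_two, (spin_eBar_Phi_mem σ Y).2]
  simp only [spin_eBar_Phi_one, twistForm_sub]
  linear_combination (-4 * (Omega ![Y, Z] * Omega ![X, W] - Omega ![X, Z] * Omega ![Y, W]) : ℂ) *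
    Complex.I_sq

/-- Untwisted, this is a triple contraction of -2 Ω ∧ Ω, the part of degree 4 of exp(-2iΩ). -/
theorem spin_spin_spin_Phi_one (X Y Z W : Phase) :
    spin (eBar σ X) (spin (eBar σ Y) (spin (eBar σ Z) (Phi σ))) 1 ![W] =
      -4 * (Omega ![Y, X] * Omega ![Z, W] - Omega ![Y, W] * Omega ![Z, X] +
        Omega ![X, W] * Omega ![Z, Y]) := by
  rw [spin_eBar_apply_one, spin_spin_Phi_two, spin_spin_Phi_zero]
  simp only [twistForm_sub]
  rw [alternating_two_swap Omega Y X, alternating_two_swap Omega Z X]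
  push_cast
  linear_combination (4 * Omega ![Z, Y] * Omega ![X, W] : ℂ) * Complex.I_sq

end Chain

/-! ### Wedging with Ω: an isomorphism from degree 1 to degree 3. -/

section OmegaOnCoordVec

theorem Omega_coordVec (X : Phase) :
    Omega ![coordVec 0, X] = X 2 ∧ Omega ![coordVec 1, X] = X 3 ∧
      Omega ![coordVec 2, X] = -X 0 ∧ Omega ![coordVec 3, X] = -X 1 := by
  refine ⟨?_, ?_, ?_, ?_⟩ <;> simp [Omega_apply, coordVec]

theorem coordVec_apply (i j : Fin 4) : coordVec i j = if j = i then 1 else 0 := by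
  simp [coordVec, Pi.single_apply]

/-- The exterior product with `Ω` is injective on covectors. -/
theorem covector_eq_zero_of_wedge_Omega {𝔸 : Type*} [NormedAddCommGroup 𝔸] [NormedSpace ℝ 𝔸]
    (a : Phase [⋀^Fin 1]→L[ℝ] 𝔸)
    (h : ∀ X Y Z, Omega ![Y, Z] • a ![X] - Omega ![X, Z] • a ![Y] + Omega ![X, Y] • a ![Z] = 0)
    (X : Phase) : a ![X] = 0 := by
  have h0 := h (coordVec 0) (coordVec 1) (coordVec 3)
  have h1 := h (coordVec 0) (coordVec 1) (coordVec 2)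
  have h2 := h (coordVec 1) (coordVec 2) (coordVec 3)
  have h3 := h (coordVec 0) (coordVec 2) (coordVec 3)
  simp [Omega_coordVec, coordVec_apply] at h0 h1 h2 h3
  rw [covector_expand, h0, h1, h2, h3]
  simp

/-- The exterior product with `Ω` maps the covectors onto the `3`-covectors. -/
theorem exists_wedge_Omega (τ : Phase [⋀^Fin 3]→L[ℝ] ℂ) :
    ∃ χ : Phase [⋀^Fin 1]→L[ℝ] ℂ, wedge (n := 3) rfl χ (complexify Omega) = τ := by
  let pr : Fin 4 → Phase →L[ℝ] ℝ := fun i => ContinuousLinearMap.proj i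
  let l : Phase →L[ℝ] ℂ :=
    (pr 0).smulRight (τ ![coordVec 0, coordVec 1, coordVec 3]) -
    (pr 1).smulRight (τ ![coordVec 0, coordVec 1, coordVec 2]) -
    (pr 2).smulRight (τ ![coordVec 1, coordVec 2, coordVec 3]) +
    (pr 3).smulRight (τ ![coordVec 0, coordVec 2, coordVec 3])
  refine ⟨ContinuousAlternatingMap.ofSubsingleton ℝ Phase ℂ (0 : Fin 1) l, ?_⟩
  have hl : ∀ X, ContinuousAlternatingMap.ofSubsingleton ℝ Phase ℂ (0 : Fin 1) l ![X] = l X :=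
    fun _ => rfl
  apply alternating_three_ext <;> rw [wedge_one_two] <;> simp only [hl, complexify_apply] <;>
    simp [Omega_coordVec, coordVec_apply, l, pr]

end OmegaOnCoordVec

/-! ### Odd forms as the direct sum of U_1 and U_{-1}. -/

section Projections

/-- The form `ξ ∧ exp β`, for `ξ` of degree `1`. -/
def oddExp (β : Phase [⋀^Fin 2]→L[ℝ] ℂ) (ξ : Phase [⋀^Fin 1]→L[ℝ] ℂ) : MixedForm :=
  ofDegree 1 ξ + ofDegree 3 (wedge (n := 3) rfl ξ β)

theorem oddExp_one (β : Phase [⋀^Fin 2]→L[ℝ] ℂ) (ξ : Phase [⋀^Fin 1]→L[ℝ] ℂ) :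
    oddExp β ξ 1 = ξ := by
  rw [oddExp, Pi.add_apply, ofDegree_same, ofDegree_of_ne (by decide), add_zero]

theorem oddExp_mem (β : Phase [⋀^Fin 2]→L[ℝ] ℂ) (ξ : Phase [⋀^Fin 1]→L[ℝ] ℂ) :
    oddExp β ξ ∈ oddExpSpace β := by
  refine ⟨fun k => ?_, fun X Y Z => ?_⟩
  · rw [oddExp, Pi.add_apply, ofDegree_of_ne (by omega), ofDegree_of_ne (by omega), add_zero]
  · rw [oddExp_one, ← wedge_one_two, oddExp, Pi.add_apply, ofDegree_same,
      ofDegree_of_ne (by decide), zero_add]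

theorem eq_of_odd {θ η : MixedForm} (hθ : ∀ k, θ (2 * k) = 0) (hη : ∀ k, η (2 * k) = 0)
    (h1 : ∀ X, θ 1 ![X] = η 1 ![X]) (h3 : ∀ X Y Z, θ 3 ![X, Y, Z] = η 3 ![X, Y, Z]) : θ = η := by
  funext n
  rcases Nat.even_or_odd' n with ⟨k, rfl | rfl⟩
  · rw [hθ, hη]
  rcases k with _ | _ | k
  · ext v
    rw [vec_one_eta v]
    exact h1 _
  · ext v
    change θ 3 v = η 3 v
    rw [vec_three_eta v, h3]
  · rw [alternating_eq_zero (by omega) (θ _), alternating_eq_zero (by omega) (η _)]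

variable (σ : Phase [⋀^Fin 2]→L[ℝ] ℝ)

theorem exists_odd_decomposition {θ : MixedForm} (hθ : ∀ k, θ (2 * k) = 0) :
    ∃ p ∈ oddExpSpace (twistForm σ (-Complex.I)), ∃ q ∈ oddExpSpace (barForm σ), p + q = θ := by
  -- The degree 1 parts of p and q must add up to θ₁; with χ their difference, the equation in
  -- degree 3 reads θ₁ ∧ σ - i χ ∧ Ω = θ₃, which is solved for χ.
  obtain ⟨χ, hχ⟩ := exists_wedge_Omega
    (Complex.I • (θ 3 - wedge (n := 3) rfl (θ 1) (complexify σ)))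
  have hχ' : ∀ X Y Z, χ ![X] * Omega ![Y, Z] - χ ![Y] * Omega ![X, Z] + χ ![Z] * Omega ![X, Y] =
      Complex.I * (θ 3 ![X, Y, Z] - (θ 1 ![X] * σ ![Y, Z] - θ 1 ![Y] * σ ![X, Z] +
        θ 1 ![Z] * σ ![X, Y])) := fun X Y Z => by
    have := congrArg (fun a => a ![X, Y, Z]) hχ
    simp only [ContinuousAlternatingMap.smul_apply, ContinuousAlternatingMap.sub_apply,
      wedge_one_two, complexify_apply, smul_eq_mul] at this
    exact this
  have hp := oddExp_mem (twistForm σ (-Complex.I)) ((1 / 2 : ℂ) • (θ 1 + χ))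
  have hq := oddExp_mem (barForm σ) ((1 / 2 : ℂ) • (θ 1 - χ))
  refine ⟨_, hp, _, hq, ?_⟩
  refine eq_of_odd (fun k => ?_) hθ (fun X => ?_) fun X Y Z => ?_
  · rw [Pi.add_apply, hp.1, hq.1, add_zero]
  · simp only [Pi.add_apply, ContinuousAlternatingMap.add_apply, oddExp_one,
      ContinuousAlternatingMap.smul_apply, ContinuousAlternatingMap.sub_apply, smul_eq_mul]
    ring
  · rw [Pi.add_apply, ContinuousAlternatingMap.add_apply, hp.2, hq.2]
    simp only [ContinuousAlternatingMap.add_apply, oddExp_one, smul_eq_mul, barForm,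
      ContinuousAlternatingMap.smul_apply, ContinuousAlternatingMap.sub_apply, twistForm_apply]
    linear_combination (-Complex.I) * hχ' X Y Z - (θ 3 ![X, Y, Z] - (θ 1 ![X] * σ ![Y, Z] -
      θ 1 ![Y] * σ ![X, Z] + θ 1 ![Z] * σ ![X, Y])) * Complex.I_sq

/-- Comparing the two formulas for the part of degree 3 gives 2i θ₁ ∧ Ω = 0, hence θ₁ = 0. -/
theorem oddExpSpace_inf_eq_zero {θ : MixedForm}
    (h : θ ∈ oddExpSpace (twistForm σ (-Complex.I))) (h' : θ ∈ oddExpSpace (barForm σ)) :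
    θ = 0 := by
  refine eq_of_mem_oddExpSpace h (Submodule.zero_mem _)
    (covector_eq_zero_of_wedge_Omega (θ 1) fun X Y Z => ?_)
  have h3 := (h.2 X Y Z).symm.trans (h'.2 X Y Z)
  simp only [barForm, twistForm_apply] at h3
  simp only [Complex.real_smul]
  linear_combination (Complex.I / 2) * h3 + (Omega ![Y, Z] * θ 1 ![X] - Omega ![X, Z] * θ 1 ![Y] +
    Omega ![X, Y] * θ 1 ![Z]) * Complex.I_sq

theorem oddExpSpace_le_gualtieriU_one :
    oddExpSpace (twistForm σ (-Complex.I)) ≤ gualtieriU σ 1 := by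
  intro θ hθ
  let D : Fin 4 → MixedForm := fun i => spin (eBar σ (coordVec i)) (Phi σ)
  -- The part of degree 1 of D i is -2i Ω(e_i, ·), a signed coordinate covector up to that factor;
  -- i/2 inverts -2i.
  have e : θ = (Complex.I / 2 * θ 1 ![coordVec 2]) • D 0 + (Complex.I / 2 * θ 1 ![coordVec 3]) • D 1
      + (-(Complex.I / 2) * θ 1 ![coordVec 0]) • D 2
      + (-(Complex.I / 2) * θ 1 ![coordVec 1]) • D 3 := by
    have hD : ∀ i, D i ∈ oddExpSpace (twistForm σ (-Complex.I)) := fun i => spin_eBar_Phi_mem σ _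
    refine eq_of_mem_oddExpSpace hθ (add_mem (add_mem (add_mem ?_ ?_) ?_) ?_) fun X => ?_
    any_goals exact Submodule.smul_mem _ _ (hD _)
    simp only [Pi.add_apply, Pi.smul_apply, ContinuousAlternatingMap.add_apply,
      ContinuousAlternatingMap.smul_apply, D, spin_eBar_Phi_one, Omega_coordVec, smul_eq_mul]
    rw [covector_expand]
    simp only [Complex.real_smul]
    push_cast
    linear_combination (-(X 0 * θ 1 ![coordVec 0] + X 1 * θ 1 ![coordVec 1] +
      X 2 * θ 1 ![coordVec 2] + X 3 * θ 1 ![coordVec 3]) : ℂ) * -Complex.I_sq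
  rw [e]
  refine add_mem (add_mem (add_mem ?_ ?_) ?_) ?_ <;>
    exact Submodule.smul_mem _ _ (spin_mem_gualtieriU_one σ _)

theorem oddExpSpace_le_gualtieriU_neg_one :
    oddExpSpace (barForm σ) ≤ gualtieriU σ (-1) := by
  intro θ hθ
  let D : Fin 4 → Fin 4 → Fin 4 → MixedForm := fun i j k => spin (eBar σ (coordVec i))
    (spin (eBar σ (coordVec j)) (spin (eBar σ (coordVec k)) (Phi σ)))
  -- Contracting a volume form with three coordinate vectors leaves the covector of the omitted
  -- index, here times ±4.
  have e : θ = (1 / 4 * θ 1 ![coordVec 0]) • D 1 2 3 + (-(1 / 4) * θ 1 ![coordVec 1]) • D 0 2 3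
      + (1 / 4 * θ 1 ![coordVec 2]) • D 0 1 3 + (-(1 / 4) * θ 1 ![coordVec 3]) • D 0 1 2 := by
    have hD : ∀ i j k, D i j k ∈ oddExpSpace (barForm σ) := fun i j k =>
      spin_eBar_mem_oddExpSpace σ (spin_spin_Phi_mem σ _ _) _
    refine eq_of_mem_oddExpSpace hθ (add_mem (add_mem (add_mem ?_ ?_) ?_) ?_) fun X => ?_
    any_goals exact Submodule.smul_mem _ _ (hD _ _ _)
    simp only [Pi.add_apply, Pi.smul_apply, ContinuousAlternatingMap.add_apply,
      ContinuousAlternatingMap.smul_apply, D, spin_spin_spin_Phi_one, Omega_coordVec, smul_eq_mul]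
    rw [covector_expand]
    simp [coordVec_apply]
    ring
  rw [e]
  refine add_mem (add_mem (add_mem ?_ ?_) ?_) ?_ <;>
    exact Submodule.smul_mem _ _ (spin_mem_gualtieriU_neg_one σ _ _ _)

theorem sum_Icc_neg_two_two (u : ℤ → MixedForm) :
    ∑ j ∈ Finset.Icc (-2 : ℤ) 2, u j = u (-2) + u (-1) + u 0 + u 1 + u 2 := by
  have : Finset.Icc (-2 : ℤ) 2 = {-2, -1, 0, 1, 2} := by decide
  rw [this]
  simp
  abel

/-- `proj` picks an arbitrary decomposition, but in any of them the components of index -2, 0 and 2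
are even, so those of index ±1 are forced by the odd part. -/
theorem proj_odd {θ p q : MixedForm} (hp : p ∈ oddExpSpace (twistForm σ (-Complex.I)))
    (hq : q ∈ oddExpSpace (barForm σ)) (h : p + q = θ) :
    proj σ 1 θ = p ∧ proj σ (-1) θ = q := by
  have hex : ∃ u : ℤ → MixedForm, (∀ j, u j ∈ gualtieriU σ j) ∧
      ∑ j ∈ Finset.Icc (-2 : ℤ) 2, u j = θ := by
    refine ⟨fun j => if j = 1 then p else if j = -1 then q else 0, fun j => ?_, ?_⟩
    · dsimp only
      split_ifs with h1 h2
      · exact h1 ▸ oddExpSpace_le_gualtieriU_one σ hp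
      · exact h2 ▸ oddExpSpace_le_gualtieriU_neg_one σ hq
      · exact Submodule.zero_mem _
    · rw [sum_Icc_neg_two_two]
      simp [← h, add_comm]
  obtain ⟨hu, hsum⟩ := hex.choose_spec
  set u := hex.choose
  rw [sum_Icc_neg_two_two] at hsum
  have m2 : ∀ k, u 2 (2 * k + 1) = 0 := by
    obtain ⟨c, hc⟩ := Submodule.mem_span_singleton.1
      (gualtieriU_le_spinChain σ 2 0 (by norm_num) (hu 2))
    intro k
    rw [← hc, Pi.smul_apply, Phi_odd, covector_smul_zero]
  have m1 : u 1 ∈ oddExpSpace (twistForm σ (-Complex.I)) :=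
    gualtieriU_le_spinChain σ 1 1 (by norm_num) (hu 1)
  have m0 : ∀ k, u 0 (2 * k + 1) = 0 := (gualtieriU_le_spinChain σ 0 2 (by norm_num) (hu 0)).1
  have n1 : u (-1) ∈ oddExpSpace (barForm σ) :=
    gualtieriU_le_spinChain σ (-1) 3 (by norm_num) (hu (-1))
  have n2 : ∀ k, u (-2) (2 * k + 1) = 0 :=
    gualtieriU_le_spinChain σ (-2) 4 (by norm_num) (hu (-2))
  -- Both sides are equal and lie in the spaces for U_1 and U_{-1} respectively, which meet in 0.
  have key : u 1 - p = q - u (-1) := by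
    funext n
    rcases Nat.even_or_odd' n with ⟨k, rfl | rfl⟩
    · rw [Pi.sub_apply, Pi.sub_apply, m1.1, hp.1, hq.1, n1.1]
    · have := congrFun (hsum.trans h.symm) (2 * k + 1)
      simp only [Pi.add_apply, m2, m0, n2, zero_add, add_zero] at this
      rw [Pi.sub_apply, Pi.sub_apply, sub_eq_sub_iff_add_eq_add,
        add_comm (u 1 _), this, add_comm (p _)]
  have hz : u 1 - p = 0 := oddExpSpace_inf_eq_zero σ (sub_mem m1 hp) (key ▸ sub_mem hq n1)
  have hz' : q - u (-1) = 0 := key ▸ hz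
  constructor
  · rw [proj, dif_pos hex]; exact sub_eq_zero.1 hz
  · rw [proj, dif_pos hex]; exact (sub_eq_zero.1 hz').symm

end Projections

/-! ### The forms U and V: components, reality, membership in U_0. -/

section RealForms

variable (σ : Phase [⋀^Fin 2]→L[ℝ] ℝ)

theorem formU_eq (ω : Phase → Phase [⋀^Fin 2]→L[ℝ] ℝ) (x : Phase) :
    formU ω x = mwedge (ofDegree 2 (complexify (ω x))) (Phi (ω x)) := rfl

theorem formV_eq (ω : Phase → Phase [⋀^Fin 2]→L[ℝ] ℝ) (x : Phase) :
    formV ω x = mwedge (ofDegree 2 (Complex.I • complexify Omega)) (Phi (ω x)) + Phi (ω x) := by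
  have h : Complex.I • ofReal Omega = ofDegree 2 (Complex.I • complexify Omega) :=
    (ofDegree_smul _ _ _).symm
  rw [formV, h, mwedge_add_left]
  congr 1
  funext n
  rw [scalar, mwedge_ofDegree (zero_add n)]
  ext v
  rw [wedge_scalar_left, one_mul]
  rfl

theorem mwedge_Phi_zero (a : Phase [⋀^Fin 2]→L[ℝ] ℂ) : mwedge (ofDegree 2 a) (Phi σ) 0 = 0 :=
  mwedge_ofDegree_of_lt (by decide) _ _

theorem mwedge_Phi_two (a : Phase [⋀^Fin 2]→L[ℝ] ℂ) : mwedge (ofDegree 2 a) (Phi σ) 2 = a := by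
  ext v
  rw [mwedge_ofDegree (q := 0) rfl, Phi_zero, wedge_scalar_right, mul_one]
  rfl

theorem mwedge_Phi_four (a : Phase [⋀^Fin 2]→L[ℝ] ℂ) (X Y Z W : Phase) :
    mwedge (ofDegree 2 a) (Phi σ) 4 ![X, Y, Z, W] =
      a ![X, Y] * twistForm σ (-Complex.I) ![Z, W] - a ![X, Z] * twistForm σ (-Complex.I) ![Y, W] +
      a ![X, W] * twistForm σ (-Complex.I) ![Y, Z] + a ![Y, Z] * twistForm σ (-Complex.I) ![X, W] -
      a ![Y, W] * twistForm σ (-Complex.I) ![X, Z] + a ![Z, W] * twistForm σ (-Complex.I) ![X, Y] := by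
  rw [mwedge_ofDegree (q := 2) rfl, Phi_two, wedge_two_two]

theorem mwedge_Phi_odd (a : Phase [⋀^Fin 2]→L[ℝ] ℂ) (k : ℕ) :
    mwedge (ofDegree 2 a) (Phi σ) (2 * k + 1) = 0 := by
  cases k with
  | zero => exact mwedge_ofDegree_of_lt (by decide) _ _
  | succ k => rw [mwedge_ofDegree (q := 2 * k + 1) (by omega), Phi_odd, wedge_zero_right]

theorem isReal_of_even {θ : MixedForm} (h : ∀ k, θ (2 * k + 1) = 0) (h0 : (θ 0 ![]).im = 0)
    (h2 : ∀ X Y, (θ 2 ![X, Y]).im = 0) (h4 : ∀ X Y Z W, (θ 4 ![X, Y, Z, W]).im = 0) :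
    IsReal θ := by
  intro n v
  rcases Nat.even_or_odd' n with ⟨k, rfl | rfl⟩
  · rcases k with _ | _ | _ | k
    · have : ∀ v : Fin 0 → Phase, (θ 0 v).im = 0 := fun v => by rw [Subsingleton.elim v ![], h0]
      exact this v
    · change (θ 2 v).im = 0
      rw [vec_two_eta v, h2]
    · change (θ 4 v).im = 0
      rw [vec_four_eta v, h4]
    · rw [alternating_eq_zero (by omega) (θ _)]; rfl
  · rw [h]; rfl

variable {ω : Phase → Phase [⋀^Fin 2]→L[ℝ] ℝ}

theorem IsPrimitive.apply (hprim : IsPrimitive ω) (x X Y Z W : Phase) :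
    ω x ![X, Y] * Omega ![Z, W] - ω x ![X, Z] * Omega ![Y, W] + ω x ![X, W] * Omega ![Y, Z] +
      ω x ![Y, Z] * Omega ![X, W] - ω x ![Y, W] * Omega ![X, Z] + ω x ![Z, W] * Omega ![X, Y] =
      0 := by
  rw [← wedge_two_two, hprim x]; rfl

theorem IsPrimitive.trace (hprim : IsPrimitive ω) (x : Phase) :
    ω x ![coordVec 0, coordVec 2] + ω x ![coordVec 1, coordVec 3] = 0 := by
  have := hprim.apply x (coordVec 0) (coordVec 1) (coordVec 2) (coordVec 3)
  simp [Omega_coordVec, coordVec_apply] at this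
  linarith

theorem formU_odd (x : Phase) (k : ℕ) : formU ω x (2 * k + 1) = 0 := by
  rw [formU_eq, mwedge_Phi_odd]

theorem formU_zero (x : Phase) : formU ω x 0 = 0 := by
  rw [formU_eq, mwedge_Phi_zero]

theorem formU_two (x : Phase) : formU ω x 2 = complexify (ω x) := by
  rw [formU_eq, mwedge_Phi_two]

/-- The part of degree 4 is ω ∧ (ω - iΩ), and its imaginary part vanishes by primitivity. -/
theorem formU_four (hprim : IsPrimitive ω) (x X Y Z W : Phase) :
    formU ω x 4 ![X, Y, Z, W] = ((2 * (ω x ![X, Y] * ω x ![Z, W] - ω x ![X, Z] * ω x ![Y, W] +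
      ω x ![X, W] * ω x ![Y, Z]) : ℝ) : ℂ) := by
  have h : ((_ : ℝ) : ℂ) = ((0 : ℝ) : ℂ) := congrArg _ (hprim.apply x X Y Z W)
  rw [formU_eq, mwedge_Phi_four]
  simp only [complexify_apply, twistForm_apply]
  push_cast at h ⊢
  linear_combination (-Complex.I) * h

theorem formV_odd (x : Phase) (k : ℕ) : formV ω x (2 * k + 1) = 0 := by
  rw [formV_eq, Pi.add_apply, mwedge_Phi_odd, Phi_odd, add_zero]

theorem formV_zero (x : Phase) :
    formV ω x 0 = ContinuousAlternatingMap.constOfIsEmpty ℝ Phase (Fin 0) 1 := by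
  rw [formV_eq, Pi.add_apply, mwedge_Phi_zero, Phi_zero, zero_add]

theorem formV_two (x : Phase) : formV ω x 2 = complexify (ω x) := by
  rw [formV_eq, Pi.add_apply, mwedge_Phi_two, Phi_two]
  ext v
  simp only [ContinuousAlternatingMap.add_apply, ContinuousAlternatingMap.smul_apply,
    twistForm_apply, complexify_apply, smul_eq_mul]
  ring

/-- The cross terms -i ω ∧ Ω from Φ and i Ω ∧ ω from the product cancel, without primitivity. -/
theorem formV_four (x X Y Z W : Phase) :
    formV ω x 4 ![X, Y, Z, W] = ((ω x ![X, Y] * ω x ![Z, W] - ω x ![X, Z] * ω x ![Y, W] +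
      ω x ![X, W] * ω x ![Y, Z] + Omega ![X, Y] * Omega ![Z, W] - Omega ![X, Z] * Omega ![Y, W] +
      Omega ![X, W] * Omega ![Y, Z] : ℝ) : ℂ) := by
  rw [formV_eq, Pi.add_apply, ContinuousAlternatingMap.add_apply, mwedge_Phi_four, Phi_four]
  simp only [complexify_apply, twistForm_apply, ContinuousAlternatingMap.smul_apply, smul_eq_mul]
  push_cast
  linear_combination (-(Omega ![X, Y] * Omega ![Z, W] - Omega ![X, Z] * Omega ![Y, W] +
      Omega ![X, W] * Omega ![Y, Z]) : ℂ) * Complex.I_sq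

theorem isReal_formU (hprim : IsPrimitive ω) (x : Phase) : IsReal (formU ω x) := by
  refine isReal_of_even (formU_odd x) ?_ (fun X Y => ?_) fun X Y Z W => ?_
  · rw [formU_zero]; rfl
  · rw [formU_two, complexify_apply, Complex.ofReal_im]
  · rw [formU_four hprim, Complex.ofReal_im]

theorem isReal_formV (x : Phase) : IsReal (formV ω x) := by
  refine isReal_of_even (formV_odd x) ?_ (fun X Y => ?_) fun X Y Z W => ?_
  · rw [formV_zero]; rfl
  · rw [formV_two, complexify_apply, Complex.ofReal_im]
  · rw [formV_four, Complex.ofReal_im]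

theorem formU_mem_evenExpSpace (hprim : IsPrimitive ω) (x : Phase) :
    formU ω x ∈ evenExpSpace (barForm (ω x)) := by
  refine ⟨formU_odd x, fun X Y Z W => ?_⟩
  have h : ((_ : ℝ) : ℂ) = ((0 : ℝ) : ℂ) := congrArg _ (hprim.apply x X Y Z W)
  rw [formU_four hprim, formU_zero]
  simp only [formU_two, complexify_apply, barForm, twistForm_apply,
    ContinuousAlternatingMap.coe_zero, Pi.zero_apply]
  push_cast at h ⊢
  linear_combination (-Complex.I) * h

theorem formV_mem_evenExpSpace (x : Phase) :
    formV ω x ∈ evenExpSpace (barForm (ω x)) := by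
  refine ⟨formV_odd x, fun X Y Z W => ?_⟩
  rw [formV_four, formV_zero]
  simp only [formV_two, complexify_apply, barForm, twistForm_apply,
    ContinuousAlternatingMap.constOfIsEmpty_apply]
  push_cast
  linear_combination (Omega ![X, Y] * Omega ![Z, W] - Omega ![X, Z] * Omega ![Y, W] +
      Omega ![X, W] * Omega ![Y, Z] : ℂ) * Complex.I_sq

theorem formV_mem_gualtieriU (x : Phase) :
    formV ω x ∈ gualtieriU (ω x) 0 := by
  let D : Fin 4 → Fin 4 → MixedForm := fun i j => spin (eBar (ω x) (coordVec i))
    (spin (eBar (ω x) (coordVec j)) (Phi (ω x)))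
  -- The bivector inverse to Ω, normalised by the part of degree 0: each of D 0 2 and D 1 3
  -- contributes 2i. Degrees 0 and 2 suffice for equality in `evenExpSpace`.
  have e : formV ω x = (-(Complex.I / 4)) • (D 0 2 + D 1 3) := by
    refine eq_of_mem_evenExpSpace (formV_mem_evenExpSpace x)
      (Submodule.smul_mem _ _ (add_mem (spin_spin_Phi_mem _ _ _) (spin_spin_Phi_mem _ _ _)))
      ?_ fun X Y => ?_
    · simp only [Pi.add_apply, Pi.smul_apply, ContinuousAlternatingMap.add_apply,
        ContinuousAlternatingMap.smul_apply, D, spin_spin_Phi_zero, formV_zero,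
        ContinuousAlternatingMap.constOfIsEmpty_apply, Omega_coordVec, smul_eq_mul]
      simp [coordVec_apply]
      linear_combination Complex.I_sq
    · simp only [Pi.add_apply, Pi.smul_apply, ContinuousAlternatingMap.add_apply,
        ContinuousAlternatingMap.smul_apply, D, spin_spin_Phi_two, formV_two, Omega_coordVec,
        smul_eq_mul, complexify_apply, twistForm_apply]
      rw [Omega_apply X Y]
      simp [coordVec_apply]
      ring_nf
      simp only [Complex.I_sq, Complex.I_pow_three]
      ring
  rw [e]
  exact Submodule.smul_mem _ _ (add_mem (spin_mem_gualtieriU_zero _ _ _)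
    (spin_mem_gualtieriU_zero _ _ _))

theorem formU_mem_gualtieriU (hprim : IsPrimitive ω) (x : Phase) :
    formU ω x ∈ gualtieriU (ω x) 0 := by
  let D : Fin 4 → Fin 4 → MixedForm := fun i j => spin (eBar (ω x) (coordVec i))
    (spin (eBar (ω x) (coordVec j)) (Phi (ω x)))
  let s : Fin 4 → Fin 4 → ℂ := fun i j => (ω x ![coordVec i, coordVec j] : ℂ)
  have ht : s 1 3 = -s 0 2 := by
    have := congrArg (fun r : ℝ => (r : ℂ)) (hprim.trace x)
    push_cast at this
    linear_combination this
  -- The coefficients are those of ω with indices raised by Ω, which exchanges 0 with 2 and 1 with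
  -- 3. The trace relation `ht` cancels the part of degree 0.
  have e : formU ω x = (-(1 / 4) * s 2 3) • D 0 1 + (-(1 / 4) * s 0 2) • D 0 2
      + (-(1 / 4) * s 1 2) • D 0 3 + (-(1 / 4) * s 0 3) • D 1 2 + (-(1 / 4) * s 1 3) • D 1 3
      + (-(1 / 4) * s 0 1) • D 2 3 := by
    refine eq_of_mem_evenExpSpace (formU_mem_evenExpSpace hprim x)
      (add_mem (add_mem (add_mem (add_mem (add_mem ?_ ?_) ?_) ?_) ?_) ?_) ?_ fun X Y => ?_
    any_goals exact Submodule.smul_mem _ _ (spin_spin_Phi_mem _ _ _)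
    · simp only [Pi.add_apply, Pi.smul_apply, ContinuousAlternatingMap.add_apply,
        ContinuousAlternatingMap.smul_apply, D, spin_spin_Phi_zero, formU_zero, Omega_coordVec,
        smul_eq_mul, ht]
      simp [coordVec_apply]
    · simp only [Pi.add_apply, Pi.smul_apply, ContinuousAlternatingMap.add_apply,
        ContinuousAlternatingMap.smul_apply, D, spin_spin_Phi_two, formU_two, Omega_coordVec,
        smul_eq_mul]
      rw [alternating_two_expand (complexify (ω x))]
      simp only [complexify_apply, Complex.real_smul]
      change (_ * s 0 1 + _ * s 0 2 + _ * s 0 3 + _ * s 1 2 + _ * s 1 3 + _ * s 2 3 : ℂ) = _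
      rw [ht]
      simp [coordVec_apply]
      ring
  rw [e]
  refine add_mem (add_mem (add_mem (add_mem (add_mem ?_ ?_) ?_) ?_) ?_) ?_ <;>
    exact Submodule.smul_mem _ _ (spin_mem_gualtieriU_zero _ _ _)

end RealForms

/-! ### Exterior derivatives of fω + gΩ and of fU + cgV. -/

section ExteriorDerivative

theorem extDeriv_two_apply {F : Type*} [NormedAddCommGroup F] [NormedSpace ℝ F]
    {τ : Phase → Phase [⋀^Fin 2]→L[ℝ] F} {x : Phase} (h : DifferentiableAt ℝ τ x)
    (X Y Z : Phase) :
    extDeriv τ x ![X, Y, Z] = fderiv ℝ (fun y => τ y ![Y, Z]) x X -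
      fderiv ℝ (fun y => τ y ![X, Z]) x Y + fderiv ℝ (fun y => τ y ![X, Y]) x Z := by
  have h1 : Fin.removeNth (1 : Fin 3) ![X, Y, Z] = ![X, Z] := by ext i : 1; fin_cases i <;> rfl
  have h2 : Fin.removeNth (2 : Fin 3) ![X, Y, Z] = ![X, Y] := by ext i : 1; fin_cases i <;> rfl
  rw [extDeriv_apply h]
  simp [Fin.sum_univ_succ, h1, h2]
  abel

theorem extDeriv_const_zero {n : ℕ} (x : Phase) :
    extDeriv (fun _ => (0 : Phase [⋀^Fin n]→L[ℝ] ℂ)) x = 0 := by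
  rw [extDeriv, fderiv_fun_const]
  ext v
  simp [ContinuousAlternatingMap.alternatizeUncurryFin_apply]

variable {f g : Phase → ℝ} {ω : Phase → Phase [⋀^Fin 2]→L[ℝ] ℝ}

theorem dfun_eq (hf : Differentiable ℝ f) (x : Phase) :
    dfun f x = ofDegree 1 (complexify
      (ContinuousAlternatingMap.ofSubsingleton ℝ Phase ℝ (0 : Fin 1) (fderiv ℝ f x))) := by
  funext n
  rcases n with _ | _ | n
  · rw [ofDegree_of_ne (by decide)]; rfl
  · have h : (fun y => scalar (f y) 0) =
        fun y => ContinuousAlternatingMap.constOfIsEmpty ℝ Phase (Fin 0) (f y : ℂ) := by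
      funext y; exact ofDegree_same _ _
    have hd : HasFDerivAt (fun y => (f y : ℂ)) (Complex.ofRealCLM.comp (fderiv ℝ f x)) x :=
      Complex.ofRealCLM.hasFDerivAt.comp x (hf x).hasFDerivAt
    change extDeriv (fun y => scalar (f y) 0) x = ofDegree 1 _ 1
    rw [h, extDeriv_constOfIsEmpty, hd.fderiv, ofDegree_same]
    rfl
  · rw [ofDegree_of_ne (by omega)]
    have h : (fun y => scalar (f y : ℂ) (n + 1)) = fun _ => 0 := by
      funext y; exact ofDegree_of_ne (by omega) _
    change extDeriv (fun y => scalar (f y) (n + 1)) x = 0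
    rw [h, extDeriv_const_zero]

theorem pairForm_three (hf : Differentiable ℝ f) (hg : Differentiable ℝ g) (x X Y Z : Phase) :
    pairForm ω f g x 3 ![X, Y, Z] =
      ((fderiv ℝ f x X * ω x ![Y, Z] - fderiv ℝ f x Y * ω x ![X, Z] + fderiv ℝ f x Z * ω x ![X, Y] +
      (fderiv ℝ g x X * Omega ![Y, Z] - fderiv ℝ g x Y * Omega ![X, Z] +
        fderiv ℝ g x Z * Omega ![X, Y]) : ℝ) : ℂ) := by
  have h : ∀ σ : Phase [⋀^Fin 2]→L[ℝ] ℝ, ofReal σ 2 = complexify σ := fun σ => ofDegree_same _ _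
  rw [pairForm, Pi.add_apply, dfun_eq hf, dfun_eq hg, mwedge_ofDegree (q := 2) rfl,
    mwedge_ofDegree (q := 2) rfl, h, h, ContinuousAlternatingMap.add_apply, wedge_one_two,
    wedge_one_two]
  simp only [complexify_apply]
  push_cast
  rfl

theorem pairForm_of_ne (hf : Differentiable ℝ f) (hg : Differentiable ℝ g) (x : Phase) {n : ℕ}
    (hn : n ≠ 3) : pairForm ω f g x n = 0 := by
  have h : ∀ (a : Phase [⋀^Fin 1]→L[ℝ] ℂ) (σ : Phase [⋀^Fin 2]→L[ℝ] ℝ),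
      mwedge (ofDegree 1 a) (ofReal σ) n = 0 := fun a σ => by
    rcases n with _ | n
    · exact mwedge_ofDegree_of_lt (by decide) _ _
    · rw [mwedge_ofDegree (add_comm 1 n), ofReal, ofDegree_of_ne (by omega), wedge_zero_right]
  rw [pairForm, Pi.add_apply, dfun_eq hf, dfun_eq hg, h, h, add_zero]

theorem extDeriv_generating (hω : Differentiable ℝ ω) (hclosed : ∀ x, extDeriv ω x = 0)
    (hf : Differentiable ℝ f) (hg : Differentiable ℝ g) (x X Y Z : Phase) :
    extDeriv (fun y => f y • ω y + g y • Omega) x ![X, Y, Z] =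
      fderiv ℝ f x X * ω x ![Y, Z] - fderiv ℝ f x Y * ω x ![X, Z] + fderiv ℝ f x Z * ω x ![X, Y] +
      (fderiv ℝ g x X * Omega ![Y, Z] - fderiv ℝ g x Y * Omega ![X, Z] +
        fderiv ℝ g x Z * Omega ![X, Y]) := by
  have hv : ∀ v : Fin 2 → Phase, HasFDerivAt (fun y => ω y v) (fderiv ℝ (fun y => ω y v) x) x :=
    fun v => DifferentiableAt.hasFDerivAt (by fun_prop)
  have hd : ∀ (v : Fin 2 → Phase) (W : Phase),
      fderiv ℝ (fun y => (f y • ω y + g y • Omega) v) x W = fderiv ℝ f x W * ω x v +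
        fderiv ℝ g x W * Omega v + f x * fderiv ℝ (fun y => ω y v) x W := fun v W => by
    have := ((hf x).hasFDerivAt.mul (hv v)).add ((hg x).hasFDerivAt.mul_const (Omega v))
    have h2 : HasFDerivAt (fun y => (f y • ω y + g y • Omega) v) _ x := this
    rw [h2.fderiv]
    simp
    ring
  have hc := congrArg (fun a => a ![X, Y, Z]) (hclosed x)
  simp only [extDeriv_two_apply (hω x), ContinuousAlternatingMap.coe_zero, Pi.zero_apply] at hc
  rw [extDeriv_two_apply (by fun_prop), hd, hd, hd]
  linear_combination (f x) * hc

theorem combUV_odd (c : ℂ) (x : Phase) (k : ℕ) : combUV ω c f g x (2 * k + 1) = 0 := by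
  rw [combUV, Pi.add_apply, Pi.smul_apply, Pi.smul_apply, formU_odd, formV_odd,
    covector_smul_zero, covector_smul_zero, add_zero]

theorem combUV_zero (c : ℂ) (x : Phase) : combUV ω c f g x 0 =
    ContinuousAlternatingMap.constOfIsEmpty ℝ Phase (Fin 0) (c * (g x : ℂ)) := by
  rw [combUV, Pi.add_apply, Pi.smul_apply, Pi.smul_apply, formU_zero, formV_zero,
    covector_smul_zero, zero_add]
  ext v
  exact mul_one _

theorem combUV_two (c : ℂ) (x : Phase) : combUV ω c f g x 2 =
    ((f x : ℂ) + c * (g x : ℂ)) • complexify (ω x) := by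
  rw [combUV, Pi.add_apply, Pi.smul_apply, Pi.smul_apply, formU_two, formV_two]
  ext v
  exact (add_mul _ _ _).symm

theorem mextDeriv_combUV_even (c : ℂ) (x : Phase) (k : ℕ) :
    mextDeriv (combUV ω c f g) x (2 * k) = 0 := by
  cases k with
  | zero => rfl
  | succ k =>
    have h : (fun y => combUV ω c f g y (2 * k + 1)) = fun _ => 0 := by
      funext y; exact combUV_odd c y k
    change extDeriv (fun y => combUV ω c f g y (2 * k + 1)) x = 0
    rw [h, extDeriv_const_zero]

theorem mextDeriv_combUV_one (hg : Differentiable ℝ g) (c : ℂ) (x X : Phase) :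
    mextDeriv (combUV ω c f g) x 1 ![X] = c * (fderiv ℝ g x X : ℂ) := by
  have h : (fun y => combUV ω c f g y 0) =
      fun y => ContinuousAlternatingMap.constOfIsEmpty ℝ Phase (Fin 0) (c * (g y : ℂ)) := by
    funext y; exact combUV_zero c y
  have hd : HasFDerivAt (fun y => c * (g y : ℂ)) (c • Complex.ofRealCLM.comp (fderiv ℝ g x)) x :=
    (Complex.ofRealCLM.hasFDerivAt.comp x (hg x).hasFDerivAt).const_mul c
  change extDeriv (fun y => combUV ω c f g y 0) x ![X] = _
  rw [h, extDeriv_constOfIsEmpty, hd.fderiv]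
  rfl

/-- The part of degree 2 is (f + cg) ω and ω is closed, so only (df + c dg) ∧ ω remains. -/
theorem mextDeriv_combUV_three (hω : Differentiable ℝ ω) (hclosed : ∀ x, extDeriv ω x = 0)
    (hf : Differentiable ℝ f) (hg : Differentiable ℝ g) (c : ℂ) (x X Y Z : Phase) :
    mextDeriv (combUV ω c f g) x 3 ![X, Y, Z] =
      (fderiv ℝ f x X + c * fderiv ℝ g x X) * ω x ![Y, Z] -
      (fderiv ℝ f x Y + c * fderiv ℝ g x Y) * ω x ![X, Z] +
      (fderiv ℝ f x Z + c * fderiv ℝ g x Z) * ω x ![X, Y] := by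
  have h : (fun y => combUV ω c f g y 2) =
      fun y => ((f y : ℂ) + c * (g y : ℂ)) • complexify (ω y) := by
    funext y; exact combUV_two c y
  have hv : ∀ v : Fin 2 → Phase, HasFDerivAt (fun y => ω y v) (fderiv ℝ (fun y => ω y v) x) x :=
    fun v => DifferentiableAt.hasFDerivAt (by fun_prop)
  have hcast : ∀ {r : Phase → ℝ} {r' : Phase →L[ℝ] ℝ}, HasFDerivAt r r' x →
      HasFDerivAt (fun y => (r y : ℂ)) (Complex.ofRealCLM.comp r') x := fun hr =>
    Complex.ofRealCLM.hasFDerivAt.comp x hr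
  have hcoef : HasFDerivAt (fun y => (f y : ℂ) + c * (g y : ℂ))
      (Complex.ofRealCLM.comp (fderiv ℝ f x) + c • Complex.ofRealCLM.comp (fderiv ℝ g x)) x :=
    (hcast (hf x).hasFDerivAt).add ((hcast (hg x).hasFDerivAt).const_mul c)
  have hd : ∀ (v : Fin 2 → Phase) (W : Phase),
      fderiv ℝ (fun y => (((f y : ℂ) + c * (g y : ℂ)) • complexify (ω y)) v) x W =
        (fderiv ℝ f x W + c * fderiv ℝ g x W) * ω x v +
        (f x + c * g x) * (fderiv ℝ (fun y => ω y v) x W : ℝ) := fun v W => by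
    have h2 : HasFDerivAt (fun y => (((f y : ℂ) + c * (g y : ℂ)) • complexify (ω y)) v) _ x :=
      hcoef.mul (hcast (hv v))
    rw [h2.fderiv]
    simp [complexify_apply]
    ring
  have hcω : Differentiable ℝ fun y => complexify (ω y) := fun y => by
    let C : (Phase [⋀^Fin 2]→L[ℝ] ℝ) →L[ℝ] (Phase [⋀^Fin 2]→L[ℝ] ℂ) :=
      ContinuousLinearMap.compContinuousAlternatingMapCLM ℝ Phase ℝ ℂ (Fin 2) Complex.ofRealCLM
    exact C.differentiableAt.comp y (hω y)
  have hdiff : DifferentiableAt ℝ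
      (fun y => ((f y : ℂ) + c * (g y : ℂ)) • complexify (ω y)) x :=
    hcoef.differentiableAt.smul (hcω x)
  have hc := congrArg (fun a => ((a ![X, Y, Z] : ℝ) : ℂ)) (hclosed x)
  simp only [extDeriv_two_apply (hω x), ContinuousAlternatingMap.coe_zero, Pi.zero_apply] at hc
  change extDeriv (fun y => combUV ω c f g y 2) x ![X, Y, Z] = _
  rw [h, extDeriv_two_apply hdiff, hd, hd, hd]
  push_cast at hc
  linear_combination ((f x : ℂ) + c * g x) * hc

end ExteriorDerivative

/-! ### Real parts, remainder terms and the main equivalences. -/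

section MainTheorem

/-- A real odd form `p + q`, with no part of degree `1`, is the real part of `2 p`, when `p` and `q`
lie in the spaces attached to `σ + i ε Ω` and `σ - i ε Ω`. -/
theorem rePart_two_smul {σ : Phase [⋀^Fin 2]→L[ℝ] ℝ} {ε : ℝ} (hε : ε ≠ 0) {θ p q : MixedForm}
    (hp : p ∈ oddExpSpace (twistForm σ (ε * Complex.I)))
    (hq : q ∈ oddExpSpace (twistForm σ (-(ε * Complex.I)))) (h : p + q = θ)
    (hreal : ∀ X Y Z, (θ 3 ![X, Y, Z]).im = 0) (h1 : θ 1 = 0) :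
    rePart ((2 : ℂ) • p) = θ := by
  have hθ : ∀ k, θ (2 * k) = 0 := fun k => by rw [← h, Pi.add_apply, hp.1, hq.1, add_zero]
  have hpq : ∀ X, q 1 ![X] = -p 1 ![X] := fun X => by
    have := congrArg (fun a => a ![X]) ((congrFun h 1).trans h1)
    simp only [Pi.add_apply, ContinuousAlternatingMap.add_apply, ContinuousAlternatingMap.coe_zero,
      Pi.zero_apply] at this
    linear_combination this
  have h3 : ∀ X Y Z, θ 3 ![X, Y, Z] = 2 * (ε * Complex.I) * (p 1 ![X] * Omega ![Y, Z] -
      p 1 ![Y] * Omega ![X, Z] + p 1 ![Z] * Omega ![X, Y]) := fun X Y Z => by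
    rw [← h, Pi.add_apply, ContinuousAlternatingMap.add_apply, hp.2, hq.2]
    simp only [hpq, twistForm_apply]
    ring
  -- As θ₃ = 2iε p₁ ∧ Ω is real, Re p₁ ∧ Ω = 0, and wedging with Ω is injective: p₁ is purely
  -- imaginary.
  have hre : ∀ X, (p 1 ![X]).re = 0 := by
    refine covector_eq_zero_of_wedge_Omega
      (Complex.reCLM.compContinuousAlternatingMap (p 1)) fun X Y Z => ?_
    have := hreal X Y Z
    rw [h3] at this
    simp at this
    have h' := this.resolve_left hε
    change Omega ![Y, Z] * (p 1 ![X]).re - Omega ![X, Z] * (p 1 ![Y]).re +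
      Omega ![X, Y] * (p 1 ![Z]).re = 0
    linear_combination h'
  have hpart : ∀ n v, rePart ((2 : ℂ) • p) n v = (((2 : ℂ) * p n v).re : ℂ) := fun _ _ => rfl
  refine eq_of_odd (fun k => ?_) hθ (fun X => ?_) fun X Y Z => ?_
  · ext v
    rw [hpart, hp.1]
    simp
  · rw [hpart, h1]
    simp [hre]
  · apply Complex.ext
    · rw [hpart, hp.2, h3]
      simp [hre, twistForm_apply]
      ring
    · rw [hpart, hreal, Complex.ofReal_im]

variable {ω : Phase → Phase [⋀^Fin 2]→L[ℝ] ℝ} {f g : Phase → ℝ}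

/-- The difference `d (f U + c g V) - (df ∧ ω + dg ∧ Ω)` lies in `U_{-1}` for `c = i`, and in `U_1`
for `c = -i`. -/
theorem mextDeriv_combUV_sub_pairForm_mem (hω : Differentiable ℝ ω)
    (hclosed : ∀ x, extDeriv ω x = 0) (hf : Differentiable ℝ f) (hg : Differentiable ℝ g) {c : ℂ}
    (hc : c ^ 2 = -1) (x : Phase) :
    mextDeriv (combUV ω c f g) x - pairForm ω f g x ∈ oddExpSpace (twistForm (ω x) c) := by
  refine ⟨fun k => ?_, fun X Y Z => ?_⟩
  · rw [Pi.sub_apply, mextDeriv_combUV_even, pairForm_of_ne hf hg x (by omega), sub_zero]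
  · simp only [Pi.sub_apply, ContinuousAlternatingMap.sub_apply,
      mextDeriv_combUV_three hω hclosed hf hg, mextDeriv_combUV_one hg, pairForm_three hf hg,
      pairForm_of_ne hf hg x (show 1 ≠ 3 by decide), twistForm_apply,
      ContinuousAlternatingMap.coe_zero, Pi.zero_apply]
    push_cast
    -- The degree 1 part of the difference is c dg, and c dg ∧ ω - dg ∧ Ω = c dg ∧ (ω + cΩ) because
    -- c² = -1.
    linear_combination (-(fderiv ℝ g x X * Omega ![Y, Z] - fderiv ℝ g x Y * Omega ![X, Z] +
        fderiv ℝ g x Z * Omega ![X, Y]) : ℂ) * hc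

/-- The form `df ∧ ω + dg ∧ Ω` vanishes exactly when `f` is a generating function with conjugate
function `g`. -/
theorem isGeneratingWithConjugate_iff (hω : ContDiff ℝ ((⊤ : ℕ∞) : WithTop ℕ∞) ω)
    (hclosed : ∀ x, extDeriv ω x = 0) (hf : ContDiff ℝ ((⊤ : ℕ∞) : WithTop ℕ∞) f)
    (hg : ContDiff ℝ ((⊤ : ℕ∞) : WithTop ℕ∞) g) :
    IsGeneratingWithConjugate ω f g ↔ ∀ x, pairForm ω f g x = 0 := by
  have hω' := hω.differentiable (by simp)
  have hf' := hf.differentiable (by simp)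
  have hg' := hg.differentiable (by simp)
  have h1 : (∀ x, pairForm ω f g x = 0) ↔
      ∀ x, extDeriv (fun y => f y • ω y + g y • Omega) x = 0 := by
    refine forall_congr' fun x => ⟨fun h => ?_, fun h => ?_⟩
    · ext v
      rw [vec_three_eta v, extDeriv_generating hω' hclosed hf' hg']
      have := pairForm_three (ω := ω) hf' hg' x (v 0) (v 1) (v 2)
      rw [h] at this
      exact (Complex.ofReal_eq_zero.1 this.symm)
    · funext n
      by_cases hn : n = 3
      · subst hn
        ext v
        rw [vec_three_eta v, pairForm_three hf' hg', ← extDeriv_generating hω' hclosed hf' hg', h]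
        simp
      · exact pairForm_of_ne hf' hg' x hn
  rw [h1]
  constructor
  -- Exact implies closed, by d² = 0; the converse is the Poincaré lemma.
  · rintro ⟨α, hα, hd⟩ x
    rw [← funext hd, extDeriv_extDeriv hα
      (by
        rw [minSmoothness_of_isRCLikeNormedField]
        exact WithTop.coe_le_coe.2 (le_top (a := (2 : ℕ∞))))]
    rfl
  · exact exists_extDeriv_eq_of_extDeriv_eq_zero _ ((hf.smul hω).add (hg.smul contDiff_const))

end MainTheorem

end MongeAmpere

end

open MongeAmpere in
/-- Closed primitive `ω`, real forms `U = ω ∧ Φ` and `V = (iΩ + 1) ∧ Φ` in `U_0`: `f` is a generating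
function with conjugate `g` iff `∂̄ (f U + i g V) = 0`, equivalently iff `∂ (f U - i g V) = 0`,
where `∂̄ = π_{k+1} ∘ d` and `∂ = π_{k-1} ∘ d` on sections of `U_k`; with the underlying identities. -/
theorem mainTheorem3
    (ω : Phase → Phase [⋀^Fin 2]→L[ℝ] ℝ) (hsmooth : ContDiff ℝ ((⊤ : ℕ∞) : WithTop ℕ∞) ω)
    (hclosed : ∀ x, extDeriv ω x = 0) (hprim : IsPrimitive ω)
    (f g : Phase → ℝ) (hf : ContDiff ℝ ((⊤ : ℕ∞) : WithTop ℕ∞) f)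
    (hg : ContDiff ℝ ((⊤ : ℕ∞) : WithTop ℕ∞) g) :
    (∀ x, IsReal (formU ω x) ∧ formU ω x ∈ gualtieriU (ω x) 0 ∧
      IsReal (formV ω x) ∧ formV ω x ∈ gualtieriU (ω x) 0) ∧
    (IsGeneratingWithConjugate ω f g ↔ ∀ x, delBar ω 0 (combUV ω Complex.I f g) x = 0) ∧
    (IsGeneratingWithConjugate ω f g ↔ ∀ x, del ω 0 (combUV ω (-Complex.I) f g) x = 0) ∧
    (∀ x, delBar ω 0 (combUV ω Complex.I f g) x = proj (ω x) 1 (pairForm ω f g x) ∧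
      rePart ((2 : ℂ) • delBar ω 0 (combUV ω Complex.I f g) x) = pairForm ω f g x) ∧
    (∀ x, del ω 0 (combUV ω (-Complex.I) f g) x = proj (ω x) (-1) (pairForm ω f g x) ∧
      rePart ((2 : ℂ) • del ω 0 (combUV ω (-Complex.I) f g) x) = pairForm ω f g x) := by
  have hω' := hsmooth.differentiable (by simp)
  have hf' := hf.differentiable (by simp)
  have hg' := hg.differentiable (by simp)
  have hdec : ∀ x, (delBar ω 0 (combUV ω Complex.I f g) x = proj (ω x) 1 (pairForm ω f g x) ∧
      rePart ((2 : ℂ) • delBar ω 0 (combUV ω Complex.I f g) x) = pairForm ω f g x) ∧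
      (del ω 0 (combUV ω (-Complex.I) f g) x = proj (ω x) (-1) (pairForm ω f g x) ∧
      rePart ((2 : ℂ) • del ω 0 (combUV ω (-Complex.I) f g) x) = pairForm ω f g x) := by
    intro x
    obtain ⟨p, hp, q, hq, hpq⟩ := exists_odd_decomposition (ω x) (θ := pairForm ω f g x)
      fun k => pairForm_of_ne hf' hg' x (by omega)
    obtain ⟨e1, e2⟩ := proj_odd (ω x) hp hq hpq
    have hI := mextDeriv_combUV_sub_pairForm_mem hω' hclosed hf' hg' Complex.I_sq x
    have hnI := mextDeriv_combUV_sub_pairForm_mem hω' hclosed hf' hg'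
      (show (-Complex.I) ^ 2 = -1 by rw [neg_sq, Complex.I_sq]) x
    -- The remainder is absorbed into the U_{-1} component here, and into the U_1 component for
    -- `d2`, leaving the projected component unchanged.
    have d1 : delBar ω 0 (combUV ω Complex.I f g) x = p :=
      (proj_odd (ω x) hp (add_mem hq hI) (by rw [← add_assoc, hpq, add_sub_cancel])).1
    have d2 : del ω 0 (combUV ω (-Complex.I) f g) x = q :=
      (proj_odd (ω x) (add_mem hp hnI) hq
        (by rw [add_right_comm, hpq, add_sub_cancel])).2
    have him : ∀ X Y Z, (pairForm ω f g x 3 ![X, Y, Z]).im = 0 := fun X Y Z => by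
      rw [pairForm_three hf' hg', Complex.ofReal_im]
    have h1 := pairForm_of_ne (ω := ω) hf' hg' x (show 1 ≠ 3 by decide)
    rw [d1, d2, e1, e2]
    refine ⟨⟨rfl, ?_⟩, rfl, ?_⟩
    -- U_1 is attached to ω - iΩ, hence ε = -1; for U_{-1} the roles of p and q are exchanged and ε
    -- = 1.
    · refine rePart_two_smul (σ := ω x) (ε := -1) (by norm_num) (q := q) ?_ ?_ hpq him h1
      · simpa using hp
      · simpa [barForm] using hq
    · refine rePart_two_smul (σ := ω x) (ε := 1) (by norm_num) (q := p) ?_ ?_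
        ((add_comm q p).trans hpq) him h1
      · simpa [barForm] using hq
      · simpa using hp
  have hz : rePart ((2 : ℂ) • (0 : MixedForm)) = 0 := by
    funext n; ext v
    change (((2 : ℂ) * 0).re : ℂ) = 0
    simp
  have hproj : ∀ x, proj (ω x) 1 0 = 0 ∧ proj (ω x) (-1) 0 = 0 := fun x =>
    proj_odd (ω x) (Submodule.zero_mem _) (Submodule.zero_mem _) (add_zero _)
  refine ⟨fun x => ⟨isReal_formU hprim x, formU_mem_gualtieriU hprim x, isReal_formV x,
    formV_mem_gualtieriU x⟩, ?_, ?_, fun x => (hdec x).1, fun x => (hdec x).2⟩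
  · rw [isGeneratingWithConjugate_iff hsmooth hclosed hf hg]
    refine forall_congr' fun x => ⟨fun h => ?_, fun h => ?_⟩
    · rw [(hdec x).1.1, h, (hproj x).1]
    -- The form is recovered from its projection as a real part, so it vanishes with it.
    · rw [← (hdec x).1.2, h, hz]
  · rw [isGeneratingWithConjugate_iff hsmooth hclosed hf hg]
    refine forall_congr' fun x => ⟨fun h => ?_, fun h => ?_⟩
    · rw [(hdec x).2.1, h, (hproj x).2]
    · rw [← (hdec x).2.2, h, hz]
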